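/- Work in the polar-coordinate model of the hyperbolic plane $\mathbb{H}^2$ with pole $O$: a point $P$ has radius $r(P)=|OP|$ and angle $\varphi(P)$ around $O$, and $|PQ|$ denotes hyperbolic distance. Let $\mathcal S\subset\mathbb{H}^2$ be a finite set of sites. A Voronoi vertex is a point $V$ with at least three closest sites; these are its incident sites, they lie on its witness circle (centre $V$, no site inside), and the far point $V'$ is the point of the witness circle with the largest radius. For a sweep radius $\hat r$, the seen sites are those with $r(S)\le\hat r$. The beach ellipse of a seen site $S$ is $E_S=\{P: |PS|=\hat r-r(P)\}$. Its active part consists of those $P\in E_S$ for which no seen site $S'\ne S$ has a point $P'\in E_{S'}$ with $\varphi(P')=\varphi(P)$ and $r(P')>r(P)$. The beach curve $\mathcal B$ is the union of the active parts, and its intersections are the points of $\mathcal B$ that lie on the beach ellipses of two distinct seen sites. Let $\bar{\mathcal Q}$ consist of $0$, the radii of all sites, and the radii of the far points of all Voronoi vertices. Let $V\neq O$ be a Voronoi vertex with exactly three incident sites whose far point $V'$ is not a site. Let $(S_1,S_2,S_3)$ be the incident sites in the order in which they are met on the witness circle when it is traversed clockwise from $V'$, and let $r$ be the largest element of $\bar{\mathcal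 Q}$ that is smaller than $r(V')$ (it exists). Then $V$ is detected by a circle event at $\hat r=r(V')$: there are points $I_{12}\in E_{S_1}\cap E_{S_2}$ and $I_{23}\in E_{S_2}\cap E_{S_3}$, depending continuously on $\hat r\in[r,r(V')]$, such that $I_{12}=I_{23}=V$ at $\hat r=r(V')$ and such that for every $\hat r\in[r,r(V'))$ both are on the beach curve $\mathcal B$, are distinct, and are consecutive there: going counterclockwise around $O$ from $I_{12}$ to $I_{23}$, there is no intersection of $\mathcal B$ strictly between them, and every point of $\mathcal B$ strictly between them is in the active part of $E_{S_2}$. -/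

import Mathlib

namespace HypSweep

/-- The polar-coordinate model of the hyperbolic plane: the point with hyperbolic distance `r` to
the pole and angle `φ` to the polar axis is the complex number `r * exp (φ * I)`; the pole is `0`.
-/
abbrev Hyp : Type := ℂ

/-- The radial coordinate. -/
noncomputable def radius (P : Hyp) : ℝ := ‖P‖

/-- The angular coordinate, normalized to `(-π, π]` (and `0` at the pole).  It is only used up to
multiples of `2 * π`. -/
noncomputable def angle (P : Hyp) : ℝ := Complex.arg P

/-- The hyperbolic distance in polar coordinates. -/
noncomputable def hdist (A B : Hyp) : ℝ :=
  Real.arcosh (Real.cosh (radius A) * Real.cosh (radius B)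
    - Real.sinh (radius A) * Real.sinh (radius B) * Real.cos (angle A - angle B))

/-- An angle reduced to `[0, 2π)`. -/
noncomputable def mod2pi (θ : ℝ) : ℝ := toIcoMod Real.two_pi_pos 0 θ

/-- The angle, in `[0, 2π)`, from the ray `OP` to the ray `OQ` counterclockwise around the pole. -/
noncomputable def ccw (P Q : Hyp) : ℝ := mod2pi (angle Q - angle P)

/-- The point of the Poincaré disk that corresponds to `P`. -/
noncomputable def toDisk (P : Hyp) : ℂ :=
  (Real.tanh (radius P / 2) : ℂ) * Complex.exp ((angle P : ℂ) * Complex.I)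

/-- The direction at `V` of the hyperbolic ray from `V` through `P`: the argument of the image of
`P` under the orientation-preserving hyperbolic isometry `z ↦ (z - v) / (1 - conj v * z)` of the
Poincaré disk, which carries `V` to the centre. -/
noncomputable def direction (V P : Hyp) : ℝ :=
  Complex.arg ((toDisk P - toDisk V) / (1 - starRingEnd ℂ (toDisk V) * toDisk P))

/-- The hyperbolic angle at `V`, in `[0, 2π)`, from the ray `VA` to the ray `VB`, measured in
clockwise direction around `V`. -/
noncomputable def cwAngle (A V B : Hyp) : ℝ := mod2pi (direction V A - direction V B)

/-! ### Voronoi vertices -/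

/-- The sites that are closest to `V`. -/
def incidentSites (𝒮 : Finset Hyp) (V : Hyp) : Set Hyp :=
  {S | S ∈ 𝒮 ∧ ∀ T ∈ 𝒮, hdist V S ≤ hdist V T}

/-- A Voronoi vertex is a point with at least three closest sites, that is, the centre of a circle
with at least three sites on it and none inside. -/
def IsVoronoiVertex (𝒮 : Finset Hyp) (V : Hyp) : Prop := 3 ≤ (incidentSites 𝒮 V).ncard

/-- The circle around `V` through its closest sites. -/
def witnessCircle (𝒮 : Finset Hyp) (V : Hyp) : Set Hyp :=
  {Q | ∃ S ∈ incidentSites 𝒮 V, hdist V Q = hdist V S}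

/-- `V'` has the largest radial coordinate among the points of the witness circle of `V`. -/
def IsFarPoint (𝒮 : Finset Hyp) (V V' : Hyp) : Prop :=
  V' ∈ witnessCircle 𝒮 V ∧ ∀ Q ∈ witnessCircle 𝒮 V, radius Q ≤ radius V'

/-- `(S₁, S₂, S₃)` lists all incident sites of `V` in the order in which they are met on the
witness circle when it is traversed clockwise from the far point `V'`. -/
def IsIncidenceTuple (𝒮 : Finset Hyp) (V V' S₁ S₂ S₃ : Hyp) : Prop :=
  incidentSites 𝒮 V = {S₁, S₂, S₃} ∧
    cwAngle V' V S₁ < cwAngle V' V S₂ ∧ cwAngle V' V S₂ < cwAngle V' V S₃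

/-- The radii of the site events and of the true circle events, together with `0`. -/
def eventRadii (𝒮 : Finset Hyp) : Set ℝ :=
  {0} ∪ {q | ∃ S ∈ 𝒮, q = radius S} ∪
    {q | ∃ W W' : Hyp, IsVoronoiVertex 𝒮 W ∧ IsFarPoint 𝒮 W W' ∧ q = radius W'}

/-! ### The beach curve at sweep radius `t` -/

/-- The sites in the closed disk bounded by the sweep circle. -/
def seenSites (𝒮 : Finset Hyp) (t : ℝ) : Set Hyp := {S | S ∈ 𝒮 ∧ radius S ≤ t}

/-- The beach ellipse of `S`: the points at equal distance to `S` and to the sweep circle.  A point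
`P` inside the sweep circle has distance `t - radius P` to it.  If `radius S = t`, this is the
segment from the pole to `S`. -/
def beachEllipse (t : ℝ) (S : Hyp) : Set Hyp := {P | hdist P S = t - radius P}

/-- The active part of the beach ellipse of `S`: the points beyond which, on the same ray from the
pole, there is no point of the beach ellipse of another seen site.  (A ray meets the ellipse of `S`
itself only once, unless `S` is on the sweep circle, where that ellipse is a segment of a ray.) -/
def activePart (𝒮 : Finset Hyp) (t : ℝ) (S : Hyp) : Set Hyp :=
  {P | P ∈ beachEllipse t S ∧ ¬ ∃ S' ∈ seenSites 𝒮 t, S' ≠ S ∧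
    ∃ P' ∈ beachEllipse t S', angle P = angle P' ∧ radius P < radius P'}

/-- The beach curve. -/
def beachCurve (𝒮 : Finset Hyp) (t : ℝ) : Set Hyp := ⋃ S ∈ seenSites 𝒮 t, activePart 𝒮 t S

/-- The intersections of two beach ellipses that are on the beach curve. -/
def beachIntersections (𝒮 : Finset Hyp) (t : ℝ) : Set Hyp :=
  {P | P ∈ beachCurve 𝒮 t ∧ ∃ S ∈ seenSites 𝒮 t, ∃ T ∈ seenSites 𝒮 t, S ≠ T ∧
    P ∈ beachEllipse t S ∩ beachEllipse t T}

/-- In counterclockwise direction around the pole, the ray through `X` is met strictly after the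
one through `P` and strictly before the one through `Q`. -/
def StrictlyBetween (P X Q : Hyp) : Prop := 0 < ccw P X ∧ ccw P X < ccw P Q

/-- `P` and `Q` are distinct intersections on the beach curve, and `Q` is the next one after `P` in
counterclockwise direction. -/
def Consecutive (𝒮 : Finset Hyp) (t : ℝ) (P Q : Hyp) : Prop :=
  P ∈ beachIntersections 𝒮 t ∧ Q ∈ beachIntersections 𝒮 t ∧ P ≠ Q ∧
    ∀ X ∈ beachIntersections 𝒮 t, ¬ StrictlyBetween P X Q

end HypSweep

namespace HypSweep

open Filter Topology

/-! ### The hyperboloid model -/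

/-! In the hyperboloid model a point at distance ρ from the pole has time coordinate cosh ρ and a
space vector of length sinh ρ, and the cosh of a distance is a Lorentz product. In direction `e`,
the beach ellipse of a site S with space vector s satisfies tanh ρ = (cosh t - cosh |OS|) / (sinh t
- ⟨s, e⟩). After clearing denominators, comparing two ellipses on a common ray means reading the
sign of `gap`, an affine function c + ⟨B, e⟩ of the unit vector `e`, with |B|² = c² + D
(`dot_gapVec_self`). Its zeros have slopes ±√D, so each of the two intersection directions can be
followed continuously in t by the sign of its slope (`meetDir`). Up to a positive factor, `gap` also
compares the distance from a point of the ellipse to the other site with its distance to the sweep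
circle (`gap_mul_sinh`). Hence sites not yet seen need no separate treatment.

At t = r(V') the ellipses of the three incident sites pass through V, and the clockwise order from
V' gives the comparisons of S₂ with S₁ and with S₃ slopes of opposite signs there (`slope_pos`).
Following the two zeros back in t gives the ends of an arc. The ends cannot collide before r(V'): a
common point of the three ellipses is equidistant from the three sites, so it is V
(`eq_of_equidistant`), and V lies on the ellipses only at t = r(V'). That S₂ is outside on the
counterclockwise arc between the ends, and that this arc shrinks to a point instead of growing to a
full turn, is decided at the larger of the radii of S₁ and S₃. There one of these two ellipses is
degenerate and the comparison is trivial, while S₂ is strictly inside the sweep circle because the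
middle site is not the highest (`timeCoord_lt_max`). The sign then persists up to r(V')
(`arc_signs`, `exists_movingArc`).

The other sites are strictly beaten at V. Going back from r(V'), consider the latest sweep radius at
which one of their ellipses reaches the arc. Contact at an end makes three ellipses meet, in a
Voronoi vertex whose far point has radius t. Contact in the interior is a tangency, which forces D =
0 and puts the site on the sweep circle. Either way t is an event radius, so it cannot lie strictly
between r and r(V') (`MovingArc.gap_neg_of_lt`). At t = r a limit gives the weak inequality.
Strictness inside the arc holds because a site appearing there would lie on the outer side
immediately afterwards (`gap_unitDir_pos`). -/

/-- The unit complex number in the direction of `P`. -/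
noncomputable def unitDir (P : Hyp) : ℂ := Complex.exp ((angle P : ℂ) * Complex.I)

/-- The time coordinate of `P` in the hyperboloid model. -/
noncomputable def timeCoord (P : Hyp) : ℝ := Real.cosh (radius P)

/-- The space coordinates of `P` in the hyperboloid model. -/
noncomputable def spaceCoord (P : Hyp) : ℂ := (Real.sinh (radius P) : ℂ) * unitDir P

/-- The Euclidean inner product of the plane. -/
def dot (z w : ℂ) : ℝ := z.re * w.re + z.im * w.im

lemma radius_nonneg (P : Hyp) : 0 ≤ radius P := norm_nonneg P

lemma norm_unitDir (P : Hyp) : ‖unitDir P‖ = 1 := Complex.norm_exp_ofReal_mul_I _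

lemma sq_add_sq_of_norm_eq_one {e : ℂ} (he : ‖e‖ = 1) : e.re ^ 2 + e.im ^ 2 = 1 := by
  have h := Complex.sq_norm e
  rw [he, Complex.normSq_apply] at h
  linarith

lemma unitDir_re (P : Hyp) : (unitDir P).re = Real.cos (angle P) := Complex.exp_ofReal_mul_I_re _

lemma unitDir_im (P : Hyp) : (unitDir P).im = Real.sin (angle P) := Complex.exp_ofReal_mul_I_im _

lemma radius_mul_unitDir (P : Hyp) : (radius P : ℂ) * unitDir P = P :=
  Complex.norm_mul_exp_arg_mul_I P

lemma radius_mul_of_norm_eq_one {ρ : ℝ} (hρ : 0 ≤ ρ) {e : ℂ} (he : ‖e‖ = 1) :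
    radius ((ρ : ℂ) * e) = ρ := by
  simp [radius, he, abs_of_nonneg hρ]

lemma unitDir_eq_div {P : Hyp} (hP : P ≠ 0) : unitDir P = P / (radius P : ℂ) := by
  have h : (radius P : ℂ) ≠ 0 := by simpa [radius] using hP
  rw [eq_div_iff h, mul_comm, radius_mul_unitDir]

lemma unitDir_mul_of_norm_eq_one {ρ : ℝ} (hρ : 0 < ρ) {e : ℂ} (he : ‖e‖ = 1) :
    unitDir ((ρ : ℂ) * e) = e := by
  have hρ' : (ρ : ℂ) ≠ 0 := by exact_mod_cast hρ.ne'
  have he' : e ≠ 0 := by rintro rfl; simp at he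
  rw [unitDir_eq_div (mul_ne_zero hρ' he'), radius_mul_of_norm_eq_one hρ.le he]
  field_simp

lemma angle_mul_unitDir {ρ : ℝ} (hρ : 0 < ρ) (X : Hyp) :
    angle ((ρ : ℂ) * unitDir X) = angle X := by
  unfold angle unitDir
  rw [Complex.arg_real_mul _ hρ, Complex.exp_mul_I]
  exact Complex.arg_cos_add_sin_mul_I ⟨Complex.neg_pi_lt_arg X, Complex.arg_le_pi X⟩

lemma spaceCoord_re (P : Hyp) : (spaceCoord P).re = Real.sinh (radius P) * (unitDir P).re :=
  Complex.re_ofReal_mul _ _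

lemma spaceCoord_im (P : Hyp) : (spaceCoord P).im = Real.sinh (radius P) * (unitDir P).im :=
  Complex.im_ofReal_mul _ _

lemma dot_ofReal_mul_left (a : ℝ) (z w : ℂ) : dot ((a : ℂ) * z) w = a * dot z w := by
  simp only [dot, Complex.re_ofReal_mul, Complex.im_ofReal_mul]; ring

lemma dot_ofReal_mul_right (a : ℝ) (z w : ℂ) : dot z ((a : ℂ) * w) = a * dot z w := by
  simp only [dot, Complex.re_ofReal_mul, Complex.im_ofReal_mul]; ring

lemma dot_unitDir_unitDir (P Q : Hyp) :
    dot (unitDir P) (unitDir Q) = Real.cos (angle P - angle Q) := by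
  simp only [dot, unitDir_re, unitDir_im, Real.cos_sub]

lemma dot_le_one {e f : ℂ} (he : ‖e‖ = 1) (hf : ‖f‖ = 1) : dot e f ≤ 1 := by
  have h1 := sq_add_sq_of_norm_eq_one he
  have h2 := sq_add_sq_of_norm_eq_one hf
  unfold dot
  nlinarith [sq_nonneg (e.re - f.re), sq_nonneg (e.im - f.im)]

lemma eq_of_one_le_dot {e f : ℂ} (he : ‖e‖ = 1) (hf : ‖f‖ = 1) (h : 1 ≤ dot e f) : e = f := by
  have h1 := sq_add_sq_of_norm_eq_one he
  have h2 := sq_add_sq_of_norm_eq_one hf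
  unfold dot at h
  have h3 : (e.re - f.re) ^ 2 + (e.im - f.im) ^ 2 ≤ 0 := by nlinarith
  apply Complex.ext <;> nlinarith [sq_nonneg (e.re - f.re), sq_nonneg (e.im - f.im)]

lemma dot_self_of_norm_eq_one {e : ℂ} (he : ‖e‖ = 1) : dot e e = 1 := by
  have h1 := sq_add_sq_of_norm_eq_one he
  unfold dot; linarith

lemma dot_spaceCoord_unitDir_self (P : Hyp) :
    dot (spaceCoord P) (unitDir P) = Real.sinh (radius P) := by
  rw [spaceCoord, dot_ofReal_mul_left, dot_self_of_norm_eq_one (norm_unitDir P), mul_one]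

lemma sinh_radius_nonneg (P : Hyp) : 0 ≤ Real.sinh (radius P) :=
  Real.sinh_nonneg_iff.2 (radius_nonneg P)

lemma dot_spaceCoord_le (P : Hyp) {e : ℂ} (he : ‖e‖ = 1) :
    dot (spaceCoord P) e ≤ Real.sinh (radius P) := by
  rw [spaceCoord, dot_ofReal_mul_left]
  exact mul_le_of_le_one_right (sinh_radius_nonneg P) (dot_le_one (norm_unitDir P) he)

lemma timeCoord_sq (P : Hyp) :
    timeCoord P ^ 2 = 1 + ((spaceCoord P).re ^ 2 + (spaceCoord P).im ^ 2) := by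
  have h := sq_add_sq_of_norm_eq_one (norm_unitDir P)
  rw [spaceCoord_re, spaceCoord_im, timeCoord, Real.cosh_sq]
  linear_combination (-Real.sinh (radius P) ^ 2) * h

lemma one_le_timeCoord (P : Hyp) : 1 ≤ timeCoord P := Real.one_le_cosh _

lemma timeCoord_lt_cosh {P : Hyp} {t : ℝ} (h : radius P < t) : timeCoord P < Real.cosh t := by
  rw [timeCoord, Real.cosh_lt_cosh, abs_of_nonneg (radius_nonneg P)]
  exact h.trans_le (le_abs_self t)

lemma timeCoord_le_cosh {P : Hyp} {t : ℝ} (h : radius P ≤ t) : timeCoord P ≤ Real.cosh t := by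
  rw [timeCoord, Real.cosh_le_cosh, abs_of_nonneg (radius_nonneg P)]
  exact h.trans (le_abs_self t)

lemma radius_eq_of_timeCoord_eq {P : Hyp} {t : ℝ} (ht : 0 ≤ t) (h : timeCoord P = Real.cosh t) :
    radius P = t := by
  exact Real.cosh_injOn (radius_nonneg P) ht h

lemma radius_lt_of_timeCoord_lt {P : Hyp} {t : ℝ} (ht : 0 ≤ t) (h : timeCoord P < Real.cosh t) :
    radius P < t := by
  rwa [timeCoord, Real.cosh_lt_cosh, abs_of_nonneg (radius_nonneg P), abs_of_nonneg ht] at h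

lemma hyp_ext {P Q : Hyp} (h : spaceCoord P = spaceCoord Q) : P = Q := by
  have hr : radius P = radius Q := by
    have := congrArg (‖·‖) h
    simp only [spaceCoord, norm_mul, norm_unitDir, mul_one, Complex.norm_real, Real.norm_eq_abs,
      abs_of_nonneg (sinh_radius_nonneg _)] at this
    exact Real.sinh_injective this
  by_cases h0 : radius P = 0
  · rw [← radius_mul_unitDir P, ← radius_mul_unitDir Q, ← hr, h0]; simp
  · have : (Real.sinh (radius P) : ℂ) ≠ 0 := by
      exact_mod_cast fun h => h0 (Real.sinh_eq_zero.1 h)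
    rw [spaceCoord, spaceCoord, ← hr] at h
    rw [← radius_mul_unitDir P, ← radius_mul_unitDir Q, ← hr, mul_left_cancel₀ this h]

/-! ### Hyperbolic distance -/

lemma hdist_eq (P Q : Hyp) : hdist P Q =
    Real.arcosh (timeCoord P * timeCoord Q - dot (spaceCoord P) (spaceCoord Q)) := by
  simp only [hdist, timeCoord, spaceCoord, dot_ofReal_mul_left, dot_ofReal_mul_right,
    dot_unitDir_unitDir]
  ring_nf

lemma cosh_radius_sub_le (P Q : Hyp) : Real.cosh (radius P - radius Q) ≤
    timeCoord P * timeCoord Q - dot (spaceCoord P) (spaceCoord Q) := by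
  rw [Real.cosh_sub, spaceCoord, spaceCoord, dot_ofReal_mul_left, dot_ofReal_mul_right,
    timeCoord, timeCoord]
  have h := dot_le_one (norm_unitDir P) (norm_unitDir Q)
  have h2 := mul_nonneg (sinh_radius_nonneg P) (sinh_radius_nonneg Q)
  nlinarith

lemma cosh_hdist (P Q : Hyp) : Real.cosh (hdist P Q) =
    timeCoord P * timeCoord Q - dot (spaceCoord P) (spaceCoord Q) := by
  rw [hdist_eq]
  exact Real.cosh_arcosh ((Real.one_le_cosh _).trans (cosh_radius_sub_le P Q))

lemma hdist_nonneg (P Q : Hyp) : 0 ≤ hdist P Q := by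
  rw [hdist_eq]
  exact Real.arcosh_nonneg ((Real.one_le_cosh _).trans (cosh_radius_sub_le P Q))

lemma hdist_eq_iff {P Q : Hyp} {d : ℝ} : hdist P Q = d ↔ 0 ≤ d ∧
    timeCoord P * timeCoord Q - dot (spaceCoord P) (spaceCoord Q) = Real.cosh d := by
  rw [← cosh_hdist]
  constructor
  · rintro rfl; exact ⟨hdist_nonneg P Q, rfl⟩
  · rintro ⟨hd, h⟩
    exact Real.cosh_injOn (hdist_nonneg P Q) hd h

lemma radius_sub_le_hdist (P Q : Hyp) : radius Q - radius P ≤ hdist P Q := by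
  have h := cosh_radius_sub_le P Q
  rw [← cosh_hdist, Real.cosh_le_cosh, abs_of_nonneg (hdist_nonneg P Q)] at h
  exact (le_abs_self _).trans (abs_sub_comm (radius Q) (radius P) ▸ h)

/-- Reverse Cauchy–Schwarz for the Lorentz form: equality would make the two hyperboloid vectors
proportional, hence equal. -/
lemma one_lt_cosh_hdist {P Q : Hyp} (h : P ≠ Q) :
    1 < timeCoord P * timeCoord Q - dot (spaceCoord P) (spaceCoord Q) := by
  have h1 := timeCoord_sq P
  have h2 := timeCoord_sq Q
  have h3 := one_le_timeCoord P
  have h4 := one_le_timeCoord Q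
  refine lt_of_le_of_ne ((Real.one_le_cosh _).trans (cosh_radius_sub_le P Q)) fun h5 => h ?_
  unfold dot at h5
  set p := timeCoord P
  set q := timeCoord Q
  set a := (spaceCoord P).re
  set b := (spaceCoord P).im
  set c := (spaceCoord Q).re
  set d := (spaceCoord Q).im
  have h6 : (p * c - q * a) ^ 2 + (p * d - q * b) ^ 2 ≤ 0 := by
    nlinarith [sq_nonneg (p - q)]
  have h7 : p * c - q * a = 0 := by nlinarith [sq_nonneg (p * c - q * a), sq_nonneg (p * d - q * b)]
  have h8 : p * d - q * b = 0 := by nlinarith [sq_nonneg (p * c - q * a), sq_nonneg (p * d - q * b)]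
  have h9 : p = q := by
    have : p * (p * q - a * c - b * d - 1) = 0 := by
      rw [show p * q - a * c - b * d - 1 = 0 by linarith, mul_zero]
    have h10 : q - p = 0 := by linear_combination this - q * h1 + a * h7 + b * h8
    linarith
  have hp : p ≠ 0 := by positivity
  apply hyp_ext
  apply Complex.ext
  · exact mul_left_cancel₀ hp (by rw [← h9] at h7; linarith)
  · exact mul_left_cancel₀ hp (by rw [← h9] at h8; linarith)

lemma hdist_pos {P Q : Hyp} (h : P ≠ Q) : 0 < hdist P Q := by
  refine lt_of_le_of_ne (hdist_nonneg P Q) fun h0 => ?_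
  have := one_lt_cosh_hdist h
  rw [← cosh_hdist, ← h0, Real.cosh_zero] at this
  exact lt_irrefl _ this

/-- A line through the origin meets the upper sheet of the hyperboloid at most once. -/
lemma eq_of_proportional {P Q : Hyp}
    (h1 : (spaceCoord P).re * timeCoord Q = (spaceCoord Q).re * timeCoord P)
    (h2 : (spaceCoord P).im * timeCoord Q = (spaceCoord Q).im * timeCoord P) : P = Q := by
  have hp := timeCoord_sq P
  have hq := timeCoord_sq Q
  have hp1 := one_le_timeCoord P
  have hq1 := one_le_timeCoord Q
  set p := timeCoord P
  set q := timeCoord Q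
  have h3 : p ^ 2 = q ^ 2 := by
    linear_combination q ^ 2 * hp - p ^ 2 * hq +
      ((spaceCoord P).re * q + (spaceCoord Q).re * p) * h1 +
      ((spaceCoord P).im * q + (spaceCoord Q).im * p) * h2
  have h4 : p = q := by nlinarith
  have hq0 : q ≠ 0 := by positivity
  rw [h4] at h1 h2
  exact hyp_ext (Complex.ext (mul_right_cancel₀ hq0 h1) (mul_right_cancel₀ hq0 h2))

/-- A point is determined by being equidistant from three given points. -/
lemma eq_of_equidistant {P W A B C : Hyp} (hAB : A ≠ B) (hBC : B ≠ C) (hAC : A ≠ C)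
    (hPA : hdist P A = hdist P B) (hPC : hdist P C = hdist P B)
    (hWA : hdist W A = hdist W B) (hWC : hdist W C = hdist W B) : P = W := by
  replace hPA := congrArg Real.cosh hPA
  replace hPC := congrArg Real.cosh hPC
  replace hWA := congrArg Real.cosh hWA
  replace hWC := congrArg Real.cosh hWC
  simp only [cosh_hdist, dot] at hPA hPC hWA hWC
  have hP1 := one_le_timeCoord P
  have hW1 := one_le_timeCoord W
  have hQ := one_lt_cosh_hdist hAB
  have hA := timeCoord_sq A
  have hB := timeCoord_sq B
  have hC := timeCoord_sq C
  -- The two triples are the Minkowski vectors A - B and C - B. Equidistance makes P and W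
  -- Lorentz-orthogonal to both, so both are parallel to their Lorentz cross product.
  obtain ⟨x, hx⟩ : ∃ x, x = timeCoord A - timeCoord B := ⟨_, rfl⟩
  obtain ⟨y, hy⟩ : ∃ y, y = (spaceCoord A).re - (spaceCoord B).re := ⟨_, rfl⟩
  obtain ⟨z, hz⟩ : ∃ z, z = (spaceCoord A).im - (spaceCoord B).im := ⟨_, rfl⟩
  obtain ⟨x', hx'⟩ : ∃ x, x = timeCoord C - timeCoord B := ⟨_, rfl⟩
  obtain ⟨y', hy'⟩ : ∃ y, y = (spaceCoord C).re - (spaceCoord B).re := ⟨_, rfl⟩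
  obtain ⟨z', hz'⟩ : ∃ z, z = (spaceCoord C).im - (spaceCoord B).im := ⟨_, rfl⟩
  have e1 : timeCoord P * x = (spaceCoord P).re * y + (spaceCoord P).im * z := by
    rw [hx, hy, hz]; linarith
  have e2 : timeCoord P * x' = (spaceCoord P).re * y' + (spaceCoord P).im * z' := by
    rw [hx', hy', hz']; linarith
  have e3 : timeCoord W * x = (spaceCoord W).re * y + (spaceCoord W).im * z := by
    rw [hx, hy, hz]; linarith
  have e4 : timeCoord W * x' = (spaceCoord W).re * y' + (spaceCoord W).im * z' := by
    rw [hx', hy', hz']; linarith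
  have p1 : (y * z' - z * y') * (spaceCoord P).re = (x * z' - z * x') * timeCoord P := by
    linear_combination z * e2 - z' * e1
  have p2 : (y * z' - z * y') * (spaceCoord P).im = (y * x' - x * y') * timeCoord P := by
    linear_combination y' * e1 - y * e2
  have w1 : (y * z' - z * y') * (spaceCoord W).re = (x * z' - z * x') * timeCoord W := by
    linear_combination z * e4 - z' * e3
  have w2 : (y * z' - z * y') * (spaceCoord W).im = (y * x' - x * y') * timeCoord W := by
    linear_combination y' * e3 - y * e4
  -- If this component of the cross product vanishes, so do the others, and A, B, C are collinear in
  -- Minkowski space. That is impossible for three distinct points of the hyperboloid.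
  by_cases c0 : y * z' - z * y' = 0
  · exfalso
    have hP0 : timeCoord P ≠ 0 := by positivity
    have c1 : x * z' - z * x' = 0 := by
      rw [c0, zero_mul] at p1
      exact (mul_eq_zero.1 p1.symm).resolve_right hP0
    have c2 : y * x' - x * y' = 0 := by
      rw [c0, zero_mul] at p2
      exact (mul_eq_zero.1 p2.symm).resolve_right hP0
    have q1 : 0 < y ^ 2 + z ^ 2 - x ^ 2 := by
      rw [hx, hy, hz]; unfold dot at hQ; nlinarith
    have n1 : 2 * ((spaceCoord B).re * y + (spaceCoord B).im * z - timeCoord B * x)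
        + (y ^ 2 + z ^ 2 - x ^ 2) = 0 := by
      rw [hx, hy, hz]; linarith
    have n2 : 2 * ((spaceCoord B).re * y' + (spaceCoord B).im * z' - timeCoord B * x')
        + (y' ^ 2 + z' ^ 2 - x' ^ 2) = 0 := by
      rw [hx', hy', hz']; linarith
    -- Here C - B = μ (A - B). The coefficient comes from projecting on the spacelike vector A - B,
    -- and the hyperboloid equation then leaves only μ = 0 and μ = 1.
    obtain ⟨μ, hμ⟩ : ∃ μ, μ * (y ^ 2 + z ^ 2 - x ^ 2) = y * y' + z * z' - x * x' :=
      ⟨_, div_mul_cancel₀ _ q1.ne'⟩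
    have mx : x' = μ * x := mul_right_cancel₀ q1.ne' (by
      linear_combination (-x) * hμ + z * (-c1) + y * c2)
    have my : y' = μ * y := mul_right_cancel₀ q1.ne' (by
      linear_combination (-y) * hμ + x * c2 - z * c0)
    have mz : z' = μ * z := mul_right_cancel₀ q1.ne' (by
      linear_combination (-z) * hμ + y * c0 - x * c1)
    have key : μ * (μ - 1) * (y ^ 2 + z ^ 2 - x ^ 2) = 0 := by
      rw [mx, my, mz] at n2
      linear_combination n2 - μ * n1
    rcases mul_eq_zero.1 ((mul_eq_zero.1 key).resolve_right q1.ne') with h | h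
    · refine hBC (hyp_ext (Complex.ext ?_ ?_))
      · rw [h] at my; linarith
      · rw [h] at mz; linarith
    · have h1 : μ = 1 := by linarith
      refine hAC (hyp_ext (Complex.ext ?_ ?_))
      · rw [h1] at my; linarith
      · rw [h1] at mz; linarith
  · apply eq_of_proportional
    · apply mul_left_cancel₀ c0
      linear_combination timeCoord W * p1 - timeCoord P * w1
    · apply mul_left_cancel₀ c0
      linear_combination timeCoord W * p2 - timeCoord P * w2

/-! ### Witness circles, far points and event radii -/

lemma timeCoord_mul {ρ : ℝ} (hρ : 0 ≤ ρ) {e : ℂ} (he : ‖e‖ = 1) :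
    timeCoord ((ρ : ℂ) * e) = Real.cosh ρ := by
  rw [timeCoord, radius_mul_of_norm_eq_one hρ he]

lemma spaceCoord_mul {ρ : ℝ} (hρ : 0 ≤ ρ) {e : ℂ} (he : ‖e‖ = 1) :
    spaceCoord ((ρ : ℂ) * e) = (Real.sinh ρ : ℂ) * e := by
  rw [spaceCoord, radius_mul_of_norm_eq_one hρ he]
  rcases hρ.eq_or_lt with rfl | h
  · simp
  · rw [unitDir_mul_of_norm_eq_one h he]

lemma hdist_radial (W : Hyp) {d : ℝ} (hd : 0 ≤ d) :
    hdist W (((radius W + d : ℝ) : ℂ) * unitDir W) = d := by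
  have h := add_nonneg (radius_nonneg W) hd
  rw [hdist_eq_iff, timeCoord_mul h (norm_unitDir W), spaceCoord_mul h (norm_unitDir W),
    dot_ofReal_mul_right, dot_spaceCoord_unitDir_self, timeCoord]
  refine ⟨hd, ?_⟩
  rw [show d = (radius W + d) - radius W by ring, Real.cosh_sub]
  ring_nf

lemma hdist_eq_of_mem_incidentSites {𝒮 : Finset Hyp} {W S T : Hyp}
    (hS : S ∈ incidentSites 𝒮 W) (hT : T ∈ incidentSites 𝒮 W) : hdist W S = hdist W T :=
  le_antisymm (hS.2 T hT.1) (hT.2 S hS.1)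

lemma hdist_eq_of_mem_witnessCircle {𝒮 : Finset Hyp} {W S Q : Hyp}
    (hS : S ∈ incidentSites 𝒮 W) (hQ : Q ∈ witnessCircle 𝒮 W) : hdist W Q = hdist W S := by
  obtain ⟨T, hT, h⟩ := hQ
  rw [h, hdist_eq_of_mem_incidentSites hT hS]

/-- Equality case of the triangle inequality with the pole. At the pole itself every point of the
circle is a far point, and the default angle 0 selects one of them. -/
lemma isFarPoint_radial {𝒮 : Finset Hyp} {W S : Hyp} (hS : S ∈ incidentSites 𝒮 W) :
    IsFarPoint 𝒮 W (((radius W + hdist W S : ℝ) : ℂ) * unitDir W) := by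
  refine ⟨⟨S, hS, hdist_radial W (hdist_nonneg W S)⟩, fun Q hQ => ?_⟩
  rw [radius_mul_of_norm_eq_one (add_nonneg (radius_nonneg W) (hdist_nonneg W S)) (norm_unitDir W)]
  have := radius_sub_le_hdist W Q
  rw [hdist_eq_of_mem_witnessCircle hS hQ] at this
  linarith

lemma IsFarPoint.radius_eq {𝒮 : Finset Hyp} {W W' S : Hyp} (h : IsFarPoint 𝒮 W W')
    (hS : S ∈ incidentSites 𝒮 W) : radius W' = radius W + hdist W S := by
  have h' := isFarPoint_radial hS
  rw [le_antisymm (h'.2 _ h.1) (h.2 _ h'.1)]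
  exact radius_mul_of_norm_eq_one (add_nonneg (radius_nonneg W) (hdist_nonneg W S))
    (norm_unitDir W)

/-- Equality in the law of cosines forces the cosine to be 1. This needs both sinh factors to be
nonzero, hence a vertex off the pole. -/
lemma IsFarPoint.eq_radial {𝒮 : Finset Hyp} {W W' S : Hyp} (h : IsFarPoint 𝒮 W W')
    (hS : S ∈ incidentSites 𝒮 W) (hW : W ≠ 0) :
    W' = ((radius W + hdist W S : ℝ) : ℂ) * unitDir W := by
  have hr := h.radius_eq hS
  have hW0 : 0 < radius W := norm_pos_iff.2 hW
  have hd := hdist_nonneg W S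
  have hc := cosh_hdist W W'
  rw [hdist_eq_of_mem_witnessCircle hS h.1, timeCoord, timeCoord, spaceCoord, spaceCoord,
    dot_ofReal_mul_left, dot_ofReal_mul_right] at hc
  have hc' : Real.cosh (hdist W S) = Real.cosh (radius W' - radius W) := by
    rw [hr]; congr 1; ring
  rw [hc', Real.cosh_sub] at hc
  have hpos : 0 < Real.sinh (radius W) * Real.sinh (radius W') :=
    mul_pos (Real.sinh_pos_iff.2 hW0) (Real.sinh_pos_iff.2 (by linarith))
  have hdot : 1 ≤ dot (unitDir W) (unitDir W') := by
    by_contra hlt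
    push Not at hlt
    nlinarith
  rw [eq_of_one_le_dot (norm_unitDir W) (norm_unitDir W') hdot, ← hr, radius_mul_unitDir]

/-- Three nearest sites already determine the vertex. This makes the vertices, and hence the event
radii, finite in number. -/
lemma injOn_incidentSites (𝒮 : Finset Hyp) :
    Set.InjOn (incidentSites 𝒮) {W | IsVoronoiVertex 𝒮 W} := by
  intro W hW U hU hWU
  obtain ⟨T, hT, hcard⟩ := Set.exists_subset_card_eq hW
  obtain ⟨A, B, C, hAB, hAC, hBC, rfl⟩ := Set.ncard_eq_three.1 hcard
  have hT' : {A, B, C} ⊆ incidentSites 𝒮 U := by rwa [← hWU]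
  have hA : A ∈ ({A, B, C} : Set Hyp) := by simp
  have hB : B ∈ ({A, B, C} : Set Hyp) := by simp
  have hC : C ∈ ({A, B, C} : Set Hyp) := by simp
  exact eq_of_equidistant hAB hBC hAC
    (hdist_eq_of_mem_incidentSites (hT hA) (hT hB)) (hdist_eq_of_mem_incidentSites (hT hC) (hT hB))
    (hdist_eq_of_mem_incidentSites (hT' hA) (hT' hB))
    (hdist_eq_of_mem_incidentSites (hT' hC) (hT' hB))

lemma finite_voronoiVertices (𝒮 : Finset Hyp) : {W | IsVoronoiVertex 𝒮 W}.Finite := by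
  refine Set.Finite.of_finite_image (Set.Finite.subset 𝒮.finite_toSet.finite_subsets ?_)
    (injOn_incidentSites 𝒮)
  rintro _ ⟨W, -, rfl⟩
  exact fun S hS => hS.1

lemma finite_eventRadii (𝒮 : Finset Hyp) : (eventRadii 𝒮).Finite := by
  refine ((Set.finite_singleton _).union ?_).union ?_
  · refine (𝒮.finite_toSet.image radius).subset ?_
    rintro q ⟨S, hS, rfl⟩
    exact ⟨S, hS, rfl⟩
  -- A far point need not be unique, but its radius is: it is the supremum of the radii on the
  -- witness circle.
  · refine ((finite_voronoiVertices 𝒮).image fun W =>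
      sSup (radius '' witnessCircle 𝒮 W)).subset ?_
    rintro q ⟨W, W', hW, hW', rfl⟩
    refine ⟨W, hW, ?_⟩
    exact IsGreatest.csSup_eq ⟨⟨W', hW'.1, rfl⟩, by rintro _ ⟨Q, hQ, rfl⟩; exact hW'.2 Q hQ⟩

lemma exists_isGreatest_eventRadii (𝒮 : Finset Hyp) {T : ℝ} (hT : 0 < T) :
    ∃ r, IsGreatest {q | q ∈ eventRadii 𝒮 ∧ q < T} r := by
  have hfin : {q | q ∈ eventRadii 𝒮 ∧ q < T}.Finite :=
    (finite_eventRadii 𝒮).subset fun q hq => hq.1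
  have hne : {q | q ∈ eventRadii 𝒮 ∧ q < T}.Nonempty := ⟨0, Or.inl (Or.inl rfl), hT⟩
  obtain ⟨r, hr, hmax⟩ := hfin.exists_maximal hne
  exact ⟨r, hr, fun q hq => (le_total q r).elim id fun h => hmax hq h⟩

lemma radius_mem_eventRadii {𝒮 : Finset Hyp} {S : Hyp} (hS : S ∈ 𝒮) : radius S ∈ eventRadii 𝒮 :=
  Or.inl (Or.inr ⟨S, hS, rfl⟩)

/-- A point with three different nearest sites makes an event. -/
lemma radius_add_hdist_mem_eventRadii {𝒮 : Finset Hyp} {W A B C : Hyp}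
    (hAB : A ≠ B) (hAC : A ≠ C) (hBC : B ≠ C) (hA : A ∈ incidentSites 𝒮 W)
    (hB : B ∈ incidentSites 𝒮 W) (hC : C ∈ incidentSites 𝒮 W) :
    radius W + hdist W A ∈ eventRadii 𝒮 := by
  have hV : IsVoronoiVertex 𝒮 W := by
    have h3 : ({A, B, C} : Set Hyp).ncard = 3 := Set.ncard_eq_three.2 ⟨A, B, C, hAB, hAC, hBC, rfl⟩
    rw [IsVoronoiVertex, ← h3]
    refine Set.ncard_le_ncard ?_ (𝒮.finite_toSet.subset fun S hS => hS.1)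
    rintro X (rfl | rfl | rfl) <;> assumption
  exact Or.inr ⟨W, _, hV, isFarPoint_radial hA, (radius_mul_of_norm_eq_one
    (add_nonneg (radius_nonneg W) (hdist_nonneg W A)) (norm_unitDir W)).symm⟩

/-! ### Hyperbolic polar coordinates around a point -/

lemma sinh_mul_one_sub_tanh_sq (x : ℝ) :
    Real.sinh x * (1 - Real.tanh (x / 2) ^ 2) = 2 * Real.tanh (x / 2) := by
  have hc : Real.cosh (x / 2) ≠ 0 := (Real.cosh_pos _).ne'
  have h := Real.cosh_sq (x / 2)
  rw [show Real.sinh x = 2 * Real.sinh (x / 2) * Real.cosh (x / 2) by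
    rw [← Real.sinh_two_mul]; ring_nf, Real.tanh_eq_sinh_div_cosh]
  field_simp
  linear_combination Real.sinh (x / 2) * h

lemma cosh_mul_one_sub_tanh_sq (x : ℝ) :
    Real.cosh x * (1 - Real.tanh (x / 2) ^ 2) = 1 + Real.tanh (x / 2) ^ 2 := by
  have hc : Real.cosh (x / 2) ≠ 0 := (Real.cosh_pos _).ne'
  have h := Real.cosh_sq (x / 2)
  rw [show Real.cosh x = Real.cosh (x / 2) ^ 2 + Real.sinh (x / 2) ^ 2 by
    rw [← Real.cosh_two_mul]; ring_nf, Real.tanh_eq_sinh_div_cosh]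
  field_simp
  linear_combination h

lemma tanh_sq_lt_one (x : ℝ) : Real.tanh x ^ 2 < 1 := by
  have hc : 0 < Real.cosh x := Real.cosh_pos _
  rw [Real.tanh_eq_sinh_div_cosh, div_pow, div_lt_one (by positivity), Real.cosh_sq]
  linarith

/-- The point of the tangent plane at `V` that corresponds to `P`, in the frame given by the radial
direction. -/
noncomputable def tangentCoord (V P : Hyp) : ℂ :=
  ⟨dot (spaceCoord P) (unitDir V) * Real.cosh (radius V) - timeCoord P * Real.sinh (radius V),
    dot (spaceCoord P) (Complex.I * unitDir V)⟩

/-- Translates the Möbius map behind `direction` into hyperboloid coordinates. A positive factor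
does not change the argument. -/
lemma mobius_eq (V P : Hyp) : ∃ c : ℝ, 0 < c ∧
    (toDisk P - toDisk V) / (1 - starRingEnd ℂ (toDisk V) * toDisk P)
      = (c : ℂ) * (tangentCoord V P * unitDir V) := by
  have hx := tanh_sq_lt_one (radius P / 2)
  have hτ := tanh_sq_lt_one (radius V / 2)
  have hs := sinh_mul_one_sub_tanh_sq (radius P)
  have hc := cosh_mul_one_sub_tanh_sq (radius P)
  have hsV := sinh_mul_one_sub_tanh_sq (radius V)
  have hcV := cosh_mul_one_sub_tanh_sq (radius V)
  have he := sq_add_sq_of_norm_eq_one (norm_unitDir V)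
  have hf := sq_add_sq_of_norm_eq_one (norm_unitDir P)
  have hP : toDisk P = (Real.tanh (radius P / 2) : ℂ) * unitDir P := rfl
  have hV : toDisk V = (Real.tanh (radius V / 2) : ℂ) * unitDir V := rfl
  set x := Real.tanh (radius P / 2)
  set τ := Real.tanh (radius V / 2)
  -- Multiplying by the conjugate denominator instead of dividing changes the quotient only by a
  -- positive real factor and leaves a polynomial identity in the half-radius tanh values.
  have hnum : (toDisk P - toDisk V) * starRingEnd ℂ (1 - starRingEnd ℂ (toDisk V) * toDisk P)
      = (((1 - x ^ 2) * (1 - τ ^ 2) / 2 : ℝ) : ℂ) * (tangentCoord V P * unitDir V) := by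
    rw [hP, hV]
    have h1 : (1 - x ^ 2) * (1 - τ ^ 2) * (dot (spaceCoord P) (unitDir V) * Real.cosh (radius V)
        - timeCoord P * Real.sinh (radius V)) =
        2 * (x * dot (unitDir P) (unitDir V) * (1 + τ ^ 2) - (1 + x ^ 2) * τ) := by
      rw [spaceCoord, dot_ofReal_mul_left, timeCoord]
      linear_combination dot (unitDir P) (unitDir V) * (Real.cosh (radius V) * (1 - τ ^ 2)) * hs +
        dot (unitDir P) (unitDir V) * 2 * x * hcV - Real.sinh (radius V) * (1 - τ ^ 2) * hc
        - (1 + x ^ 2) * hsV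
    have h2 : (1 - x ^ 2) * dot (spaceCoord P) (Complex.I * unitDir V) =
        2 * x * dot (unitDir P) (Complex.I * unitDir V) := by
      rw [spaceCoord, dot_ofReal_mul_left]
      linear_combination dot (unitDir P) (Complex.I * unitDir V) * hs
    have h3 : (((1 - x ^ 2) * (1 - τ ^ 2) / 2 : ℝ) : ℂ) * tangentCoord V P =
        x * (unitDir P * starRingEnd ℂ (unitDir V)) +
          ((τ ^ 2 * x : ℝ) : ℂ) * (starRingEnd ℂ (unitDir P) * unitDir V) -
          (((1 + x ^ 2) * τ : ℝ) : ℂ) := by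
      apply Complex.ext
      · rw [Complex.re_ofReal_mul]
        simp only [Complex.sub_re, Complex.add_re, Complex.re_ofReal_mul, Complex.ofReal_re]
        simp [tangentCoord, dot] at h1 ⊢
        linear_combination h1 / 2
      · rw [Complex.im_ofReal_mul]
        simp only [Complex.sub_im, Complex.add_im, Complex.im_ofReal_mul, Complex.ofReal_im]
        simp [tangentCoord, dot] at h2 ⊢
        linear_combination (1 - τ ^ 2) / 2 * h2
    have he' : unitDir V * starRingEnd ℂ (unitDir V) = 1 := by
      rw [Complex.mul_conj']; simp [norm_unitDir]
    have hf' : unitDir P * starRingEnd ℂ (unitDir P) = 1 := by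
      rw [Complex.mul_conj']; simp [norm_unitDir]
    rw [← mul_assoc (Complex.ofReal _) (tangentCoord V P), h3]
    push_cast
    simp only [map_sub, map_one, map_mul, Complex.conj_conj, Complex.conj_ofReal]
    linear_combination (-(x : ℂ) * unitDir P) * he' - (τ : ℂ) * x ^ 2 * unitDir V * hf'
  have hden : 1 - starRingEnd ℂ (toDisk V) * toDisk P ≠ 0 := by
    intro h0
    have h1 : ‖starRingEnd ℂ (toDisk V) * toDisk P‖ = 1 := by
      rw [← sub_eq_zero.1 h0]; simp
    rw [hP, hV, norm_mul, RCLike.norm_conj, norm_mul, norm_mul, norm_unitDir, norm_unitDir,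
      Complex.norm_real, Complex.norm_real, mul_one, mul_one, Real.norm_eq_abs,
      Real.norm_eq_abs] at h1
    have h2 : |τ| < 1 := (sq_lt_one_iff_abs_lt_one τ).1 hτ
    have h3 : |x| < 1 := (sq_lt_one_iff_abs_lt_one x).1 hx
    nlinarith [abs_nonneg τ, abs_nonneg x]
  have hpos : 0 < Complex.normSq (1 - starRingEnd ℂ (toDisk V) * toDisk P) :=
    Complex.normSq_pos.2 hden
  refine ⟨(1 - x ^ 2) * (1 - τ ^ 2) / 2 *
    (Complex.normSq (1 - starRingEnd ℂ (toDisk V) * toDisk P))⁻¹, ?_, ?_⟩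
  · have : 0 < 1 - x ^ 2 := by linarith
    have : 0 < 1 - τ ^ 2 := by linarith
    positivity
  · rw [div_eq_mul_inv, Complex.inv_def, ← mul_assoc, hnum]
    push_cast
    ring

/-- The boost taking V to the pole preserves the Lorentz form, so the space part of the image of P
has squared length cosh² d - 1. -/
lemma norm_tangentCoord (V P : Hyp) : ‖tangentCoord V P‖ = Real.sinh (hdist V P) := by
  rw [← sq_eq_sq₀ (norm_nonneg _) (Real.sinh_nonneg_iff.2 (hdist_nonneg V P)), Complex.sq_norm,
    Complex.normSq_apply, Real.sinh_sq, cosh_hdist]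
  have h1 := timeCoord_sq P
  have h2 := Real.cosh_sq (radius V)
  have h3 := sq_add_sq_of_norm_eq_one (norm_unitDir V)
  rw [show timeCoord V = Real.cosh (radius V) from rfl,
    show spaceCoord V = (Real.sinh (radius V) : ℂ) * unitDir V from rfl, dot_ofReal_mul_left]
  simp only [tangentCoord, dot, Complex.mul_re, Complex.mul_im, Complex.I_re, Complex.I_im]
  generalize timeCoord P = c at *
  generalize (spaceCoord P).re = a at *
  generalize (spaceCoord P).im = b at *
  generalize (unitDir V).re = m at *
  generalize (unitDir V).im = n at *
  generalize Real.cosh (radius V) = C at *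
  generalize Real.sinh (radius V) = D at *
  linear_combination ((a * m + b * n) ^ 2 - c ^ 2) * h2 + (a ^ 2 + b ^ 2) * h3 - h1

/-- The direction of `P` at `V` in terms of hyperboloid coordinates. -/
lemma tangentCoord_eq (V P : Hyp) : tangentCoord V P =
    (Real.sinh (hdist V P) : ℂ) *
      Complex.exp (((direction V P - angle V : ℝ) : ℂ) * Complex.I) := by
  obtain ⟨c, hc, h⟩ := mobius_eq V P
  have hdir : direction V P = Complex.arg (tangentCoord V P * unitDir V) := by
    rw [direction, h, Complex.arg_real_mul _ hc]
  have h1 := Complex.norm_mul_exp_arg_mul_I (tangentCoord V P * unitDir V)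
  rw [← hdir, norm_mul, norm_unitDir, mul_one, norm_tangentCoord] at h1
  have h2 : unitDir V ≠ 0 := Complex.exp_ne_zero _
  apply mul_right_cancel₀ h2
  rw [← h1, unitDir, mul_assoc, ← Complex.exp_add]
  congr 2
  push_cast
  ring

lemma exp_mod2pi (θ : ℝ) :
    Complex.exp ((mod2pi θ : ℂ) * Complex.I) = Complex.exp ((θ : ℂ) * Complex.I) := by
  have h := toIcoMod_add_toIcoDiv_zsmul Real.two_pi_pos 0 θ
  rw [mod2pi]
  nth_rewrite 2 [← h]
  push_cast
  rw [add_mul, Complex.exp_add, zsmul_eq_mul]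
  have : ((((toIcoDiv Real.two_pi_pos 0 θ : ℤ) : ℝ) * (2 * Real.pi) : ℝ) : ℂ) * Complex.I
      = (toIcoDiv Real.two_pi_pos 0 θ : ℤ) * (2 * Real.pi * Complex.I) := by
    push_cast; ring
  push_cast at this
  rw [this, Complex.exp_int_mul_two_pi_mul_I, mul_one]

lemma mod2pi_nonneg (θ : ℝ) : 0 ≤ mod2pi θ := (toIcoMod_mem_Ico' Real.two_pi_pos θ).1

lemma mod2pi_lt (θ : ℝ) : mod2pi θ < 2 * Real.pi := (toIcoMod_mem_Ico' Real.two_pi_pos θ).2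

lemma cos_mod2pi (θ : ℝ) : Real.cos (mod2pi θ) = Real.cos θ := by
  have := congrArg Complex.re (exp_mod2pi θ)
  rwa [Complex.exp_ofReal_mul_I_re, Complex.exp_ofReal_mul_I_re] at this

lemma sin_mod2pi (θ : ℝ) : Real.sin (mod2pi θ) = Real.sin θ := by
  have := congrArg Complex.im (exp_mod2pi θ)
  rwa [Complex.exp_ofReal_mul_I_im, Complex.exp_ofReal_mul_I_im] at this

/-- Polar coordinates around `V`, the angle being measured clockwise from the outward radial
direction. -/
lemma coords_of_cwAngle {V V' S : Hyp} {R : ℝ} (hR : 0 < R)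
    (hV' : V' = ((radius V + R : ℝ) : ℂ) * unitDir V) (hS : hdist V S = R) :
    timeCoord S = Real.cosh (radius V) * Real.cosh R +
      Real.sinh (radius V) * Real.sinh R * Real.cos (cwAngle V' V S) ∧
    dot (spaceCoord S) (unitDir V) = Real.sinh (radius V) * Real.cosh R +
      Real.cosh (radius V) * Real.sinh R * Real.cos (cwAngle V' V S) ∧
    dot (spaceCoord S) (Complex.I * unitDir V) = -(Real.sinh R * Real.sin (cwAngle V' V S)) := by
  have hsR : 0 < Real.sinh R := Real.sinh_pos_iff.2 hR
  have hn := sq_add_sq_of_norm_eq_one (norm_unitDir V)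
  have hrad := add_nonneg (radius_nonneg V) hR.le
  -- V' lies on the outward ray, so its direction at V agrees with `angle V` modulo 2π. The
  -- clockwise angle from V' is therefore minus the polar angle in the radial frame.
  have hfar : tangentCoord V V' = (Real.sinh R : ℂ) := by
    rw [hV', tangentCoord, timeCoord_mul hrad (norm_unitDir V),
      spaceCoord_mul hrad (norm_unitDir V), dot_ofReal_mul_left, dot_ofReal_mul_left,
      dot_self_of_norm_eq_one (norm_unitDir V)]
    apply Complex.ext
    · simp only [Complex.ofReal_re]
      have h := Real.sinh_sub (radius V + R) (radius V)
      rw [add_sub_cancel_left] at h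
      linear_combination -h
    · simp [dot]; right; ring
  have hd : hdist V V' = R := by rw [hV']; exact hdist_radial V hR.le
  have hfar' := tangentCoord_eq V V'
  rw [hfar, hd] at hfar'
  have hone : Complex.exp (((direction V V' - angle V : ℝ) : ℂ) * Complex.I) = 1 := by
    have h0 : (Real.sinh R : ℂ) ≠ 0 := by exact_mod_cast hsR.ne'
    apply mul_left_cancel₀ h0
    rw [← hfar', mul_one]
  have hc1 : Real.cos (direction V V' - angle V) = 1 := by
    rw [← Complex.exp_ofReal_mul_I_re, hone, Complex.one_re]
  have hs0 : Real.sin (direction V V' - angle V) = 0 := by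
    rw [← Complex.exp_ofReal_mul_I_im, hone, Complex.one_im]
  have hcos : Real.cos (cwAngle V' V S) = Real.cos (direction V S - angle V) := by
    rw [cwAngle, cos_mod2pi, show direction V V' - direction V S =
      (direction V V' - angle V) - (direction V S - angle V) by ring, Real.cos_sub, hc1, hs0]
    ring
  have hsin : Real.sin (cwAngle V' V S) = -Real.sin (direction V S - angle V) := by
    rw [cwAngle, sin_mod2pi, show direction V V' - direction V S =
      (direction V V' - angle V) - (direction V S - angle V) by ring, Real.sin_sub, hc1, hs0]
    ring
  have ht := tangentCoord_eq V S
  rw [hS] at ht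
  have hre := congrArg Complex.re ht
  have him := congrArg Complex.im ht
  rw [Complex.re_ofReal_mul, Complex.exp_ofReal_mul_I_re] at hre
  rw [Complex.im_ofReal_mul, Complex.exp_ofReal_mul_I_im] at him
  simp only [tangentCoord] at hre him
  have hch := cosh_hdist V S
  rw [hS, spaceCoord, dot_ofReal_mul_left] at hch
  have hcomm : dot (unitDir V) (spaceCoord S) = dot (spaceCoord S) (unitDir V) := by
    simp only [dot]; ring
  rw [hcomm, show timeCoord V = Real.cosh (radius V) from rfl] at hch
  have hsq := Real.cosh_sq (radius V)
  rw [hcos, hsin]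
  refine ⟨?_, ?_, ?_⟩
  -- `hre` and `hch` are the two components of a boost; cosh² - sinh² = 1 inverts it.
  · linear_combination (-timeCoord S) * hsq + Real.sinh (radius V) * hre -
      Real.cosh (radius V) * hch
  · linear_combination (-dot (spaceCoord S) (unitDir V)) * hsq + Real.cosh (radius V) * hre -
      Real.sinh (radius V) * hch
  · linear_combination him

lemma eq_of_dot_eq {e z w : ℂ} (he : ‖e‖ = 1) (h1 : dot z e = dot w e)
    (h2 : dot z (Complex.I * e) = dot w (Complex.I * e)) : z = w := by
  have hn := sq_add_sq_of_norm_eq_one he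
  simp only [dot, Complex.mul_re, Complex.mul_im, Complex.I_re, Complex.I_im] at h1 h2
  apply Complex.ext
  · linear_combination e.re * h1 - e.im * h2 + (w.re - z.re) * hn
  · linear_combination e.im * h1 + e.re * h2 + (w.im - z.im) * hn

lemma eq_of_cwAngle_eq {V V' S T : Hyp} {R : ℝ} (hR : 0 < R)
    (hV' : V' = ((radius V + R : ℝ) : ℂ) * unitDir V) (hS : hdist V S = R) (hT : hdist V T = R)
    (h : cwAngle V' V S = cwAngle V' V T) : S = T := by
  obtain ⟨-, hS1, hS2⟩ := coords_of_cwAngle hR hV' hS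
  obtain ⟨-, hT1, hT2⟩ := coords_of_cwAngle hR hV' hT
  rw [h] at hS1 hS2
  exact hyp_ext (eq_of_dot_eq (norm_unitDir V) (hS1.trans hT1.symm) (hS2.trans hT2.symm))

lemma cwAngle_pos {V V' S : Hyp} {R : ℝ} (hR : 0 < R)
    (hV' : V' = ((radius V + R : ℝ) : ℂ) * unitDir V) (hS : hdist V S = R) (hne : S ≠ V') :
    0 < cwAngle V' V S := by
  refine lt_of_le_of_ne (mod2pi_nonneg _) fun h => hne ?_
  refine eq_of_cwAngle_eq hR hV' hS (by rw [hV']; exact hdist_radial V hR.le) ?_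
  rw [← h, cwAngle, sub_self, mod2pi, toIcoMod_apply_left]

/-! ### Half-angle formulas on the witness circle -/

lemma cosh_sub_timeCoord {V V' S : Hyp} {R : ℝ} (hR : 0 < R)
    (hV' : V' = ((radius V + R : ℝ) : ℂ) * unitDir V) (hS : hdist V S = R) :
    Real.cosh (radius V + R) - timeCoord S =
      2 * (Real.sinh (radius V) * Real.sinh R) * Real.sin (cwAngle V' V S / 2) ^ 2 := by
  obtain ⟨h, -, -⟩ := coords_of_cwAngle hR hV' hS
  rw [h, Real.cosh_add]
  have h2 := Real.cos_two_mul (cwAngle V' V S / 2)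
  rw [mul_div_cancel₀ _ two_ne_zero] at h2
  rw [h2]
  linear_combination 2 * (Real.sinh (radius V) * Real.sinh R) *
    (-Real.sin_sq_add_cos_sq (cwAngle V' V S / 2))

/-- The left side is the angular derivative of `gap S T` in the direction of V at sweep radius
r(V'). Half angles lie in [0, π), so away from V' its sign records the clockwise order of the two
sites. -/
lemma slope_eq_sin {V V' S T : Hyp} {R : ℝ} (hR : 0 < R)
    (hV' : V' = ((radius V + R : ℝ) : ℂ) * unitDir V) (hS : hdist V S = R) (hT : hdist V T = R) :
    (Real.cosh (radius V + R) - timeCoord S) * dot (spaceCoord T) (Complex.I * unitDir V) -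
      (Real.cosh (radius V + R) - timeCoord T) * dot (spaceCoord S) (Complex.I * unitDir V) =
    4 * (Real.sinh (radius V) * Real.sinh R ^ 2) *
      (Real.sin (cwAngle V' V S / 2) * Real.sin (cwAngle V' V T / 2)) *
      Real.sin (cwAngle V' V T / 2 - cwAngle V' V S / 2) := by
  rw [cosh_sub_timeCoord hR hV' hS, cosh_sub_timeCoord hR hV' hT,
    (coords_of_cwAngle hR hV' hS).2.2, (coords_of_cwAngle hR hV' hT).2.2, Real.sin_sub]
  have h1 := Real.sin_two_mul (cwAngle V' V S / 2)
  have h2 := Real.sin_two_mul (cwAngle V' V T / 2)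
  rw [mul_div_cancel₀ _ two_ne_zero] at h1 h2
  rw [h1, h2]
  ring

lemma sin_half_cwAngle_pos {V V' S : Hyp} (h : 0 < cwAngle V' V S) :
    0 < Real.sin (cwAngle V' V S / 2) := by
  have : cwAngle V' V S < 2 * Real.pi := mod2pi_lt _
  exact Real.sin_pos_of_pos_of_lt_pi (by linarith) (by linarith)

lemma slope_pos {V V' S T : Hyp} {R : ℝ} (hR : 0 < R) (hV : V ≠ 0)
    (hV' : V' = ((radius V + R : ℝ) : ℂ) * unitDir V) (hS : hdist V S = R) (hT : hdist V T = R)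
    (hS0 : 0 < cwAngle V' V S) (h : cwAngle V' V S < cwAngle V' V T) :
    0 < (Real.cosh (radius V + R) - timeCoord S) * dot (spaceCoord T) (Complex.I * unitDir V) -
      (Real.cosh (radius V + R) - timeCoord T) * dot (spaceCoord S) (Complex.I * unitDir V) := by
  rw [slope_eq_sin hR hV' hS hT]
  have hv : 0 < Real.sinh (radius V) := Real.sinh_pos_iff.2 (norm_pos_iff.2 hV)
  have h1 := sin_half_cwAngle_pos hS0
  have h2 := sin_half_cwAngle_pos (hS0.trans h)
  have h3 : 0 < Real.sinh R := Real.sinh_pos_iff.2 hR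
  have h4 : cwAngle V' V T < 2 * Real.pi := mod2pi_lt _
  have h5 : 0 < Real.sin (cwAngle V' V T / 2 - cwAngle V' V S / 2) :=
    Real.sin_pos_of_pos_of_lt_pi (by linarith) (by linarith)
  positivity

/-- Among three points on a circle, the middle one is not the one of largest radius. -/
lemma timeCoord_lt_max {V V' S₁ S₂ S₃ : Hyp} {R : ℝ} (hR : 0 < R) (hV : V ≠ 0)
    (hV' : V' = ((radius V + R : ℝ) : ℂ) * unitDir V) (hS₁ : hdist V S₁ = R)
    (hS₂ : hdist V S₂ = R) (hS₃ : hdist V S₃ = R) (h0 : 0 < cwAngle V' V S₁)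
    (h12 : cwAngle V' V S₁ < cwAngle V' V S₂) (h23 : cwAngle V' V S₂ < cwAngle V' V S₃) :
    timeCoord S₂ < timeCoord S₁ ∨ timeCoord S₂ < timeCoord S₃ := by
  have hv : 0 < Real.sinh (radius V) := Real.sinh_pos_iff.2 (norm_pos_iff.2 hV)
  have hsR : 0 < Real.sinh R := Real.sinh_pos_iff.2 hR
  have hK := mul_pos hv hsR
  have e1 := cosh_sub_timeCoord hR hV' hS₁
  have e2 := cosh_sub_timeCoord hR hV' hS₂
  have e3 := cosh_sub_timeCoord hR hV' hS₃
  have s1 := sin_half_cwAngle_pos h0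
  have s3 := sin_half_cwAngle_pos (h0.trans (h12.trans h23))
  have h4 : cwAngle V' V S₃ < 2 * Real.pi := mod2pi_lt _
  -- The sine increases up to π/2 and decreases after it, so one neighbour of S₂ has a smaller
  -- half-angle sine, which means a larger radius.
  rcases le_total (cwAngle V' V S₂ / 2) (Real.pi / 2) with h | h
  · left
    have hlt : Real.sin (cwAngle V' V S₁ / 2) < Real.sin (cwAngle V' V S₂ / 2) :=
      Real.sin_lt_sin_of_lt_of_le_pi_div_two (by linarith [Real.pi_pos]) h (by linarith)
    have := pow_lt_pow_left₀ hlt s1.le two_ne_zero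
    nlinarith
  · right
    have hlt : Real.sin (cwAngle V' V S₃ / 2) < Real.sin (cwAngle V' V S₂ / 2) := by
      rw [← Real.sin_pi_sub (cwAngle V' V S₃ / 2), ← Real.sin_pi_sub (cwAngle V' V S₂ / 2)]
      exact Real.sin_lt_sin_of_lt_of_le_pi_div_two (by linarith) (by linarith) (by linarith)
    have := pow_lt_pow_left₀ hlt s3.le two_ne_zero
    nlinarith

/-! ### Beach ellipses in polar coordinates -/

/-- Expanding cosh (t - ρ) turns the law of cosines into an equation linear in cosh ρ and sinh ρ, so
tanh ρ is an explicit quotient. -/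
lemma mem_beachEllipse_iff {t ρ : ℝ} {S : Hyp} {e : ℂ} (hρ : 0 ≤ ρ) (he : ‖e‖ = 1) :
    (ρ : ℂ) * e ∈ beachEllipse t S ↔ ρ ≤ t ∧ (Real.cosh t - timeCoord S) * Real.cosh ρ =
      Real.sinh ρ * (Real.sinh t - dot (spaceCoord S) e) := by
  have hcomm : dot e (spaceCoord S) = dot (spaceCoord S) e := by simp only [dot]; ring
  rw [beachEllipse, Set.mem_ofPred_eq, hdist_eq_iff, radius_mul_of_norm_eq_one hρ he, sub_nonneg,
    timeCoord_mul hρ he, spaceCoord_mul hρ he, dot_ofReal_mul_left, hcomm, Real.cosh_sub]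
  refine and_congr_right fun _ => ⟨fun h => ?_, fun h => ?_⟩ <;> linarith

lemma cosh_sub_lt_sinh_sub {s t : ℝ} (h : s < t) :
    Real.cosh t - Real.cosh s < Real.sinh t - Real.sinh s := by
  have h1 := Real.cosh_sub_sinh t
  have h2 := Real.cosh_sub_sinh s
  have h3 : Real.exp (-t) < Real.exp (-s) := Real.exp_lt_exp.2 (by linarith)
  linarith

/-- This places the quotient for tanh ρ in (0, 1), so the ellipse of a site strictly inside the
sweep circle meets every ray exactly once. The upper bound comes from cosh - sinh = exp (-·) being
decreasing. -/
lemma ellipse_ratio_mem {t : ℝ} {S : Hyp} {e : ℂ} (he : ‖e‖ = 1) (hS : radius S < t) :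
    0 < Real.cosh t - timeCoord S ∧
      Real.cosh t - timeCoord S < Real.sinh t - dot (spaceCoord S) e := by
  refine ⟨sub_pos.2 (timeCoord_lt_cosh hS), ?_⟩
  have h1 := cosh_sub_lt_sinh_sub hS
  have h2 := dot_spaceCoord_le S he
  rw [timeCoord]
  linarith

/-- The radius of the point of the beach ellipse of `S` in direction `e`. -/
noncomputable def ellipseRadius (t : ℝ) (S : Hyp) (e : ℂ) : ℝ :=
  Real.artanh ((Real.cosh t - timeCoord S) / (Real.sinh t - dot (spaceCoord S) e))

/-- The point of the beach ellipse of `S` in direction `e`. -/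
noncomputable def ellipsePoint (t : ℝ) (S : Hyp) (e : ℂ) : Hyp := (ellipseRadius t S e : ℂ) * e

section ellipsePoint

variable {t : ℝ} {S : Hyp} {e : ℂ}

lemma ratio_mem_Ioo (he : ‖e‖ = 1) (hS : radius S < t) :
    (Real.cosh t - timeCoord S) / (Real.sinh t - dot (spaceCoord S) e) ∈ Set.Ioo (0 : ℝ) 1 := by
  obtain ⟨h1, h2⟩ := ellipse_ratio_mem he hS
  exact ⟨div_pos h1 (h1.trans h2), (div_lt_one (h1.trans h2)).2 h2⟩

lemma ellipseRadius_pos (he : ‖e‖ = 1) (hS : radius S < t) : 0 < ellipseRadius t S e :=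
  Real.artanh_pos (ratio_mem_Ioo he hS)

lemma ellipseRadius_spec (he : ‖e‖ = 1) (hS : radius S < t) :
    (Real.cosh t - timeCoord S) * Real.cosh (ellipseRadius t S e) =
      Real.sinh (ellipseRadius t S e) * (Real.sinh t - dot (spaceCoord S) e) := by
  obtain ⟨h1, h2⟩ := ellipse_ratio_mem he hS
  obtain ⟨h3, h4⟩ := ratio_mem_Ioo he hS
  have h := Real.tanh_artanh ⟨by linarith, h4⟩
  rw [Real.tanh_eq_sinh_div_cosh, ← ellipseRadius,
    div_eq_div_iff (Real.cosh_pos _).ne' (h1.trans h2).ne'] at h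
  exact h.symm

lemma ellipseRadius_le (he : ‖e‖ = 1) (hS : radius S < t) : ellipseRadius t S e ≤ t := by
  have ht : 0 < t := (radius_nonneg S).trans_lt hS
  obtain ⟨h1, h2⟩ := ellipse_ratio_mem he hS
  obtain ⟨h3, h4⟩ := ratio_mem_Ioo he hS
  have hc := Real.cosh_pos t
  rw [ellipseRadius]
  conv_rhs => rw [← Real.artanh_tanh t]
  refine Real.artanh_le_artanh (by linarith) ?_ ?_
  · nlinarith [tanh_sq_lt_one t]
  · rw [Real.tanh_eq_sinh_div_cosh, div_le_div_iff₀ (h1.trans h2) hc]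
    -- After cross-multiplication, the worst direction is that of S, where the claim is exactly cosh
    -- (t - |OS|) ≥ 1.
    have h5 := Real.one_le_cosh (t - radius S)
    rw [Real.cosh_sub, ← timeCoord] at h5
    have h6 := dot_spaceCoord_le S he
    have h7 := Real.cosh_sq t
    have h8 : 0 < Real.sinh t := Real.sinh_pos_iff.2 ht
    nlinarith

lemma ellipsePoint_mem (he : ‖e‖ = 1) (hS : radius S < t) :
    ellipsePoint t S e ∈ beachEllipse t S :=
  (mem_beachEllipse_iff (ellipseRadius_pos he hS).le he).2
    ⟨ellipseRadius_le he hS, ellipseRadius_spec he hS⟩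

lemma radius_ellipsePoint (he : ‖e‖ = 1) (hS : radius S < t) :
    radius (ellipsePoint t S e) = ellipseRadius t S e :=
  radius_mul_of_norm_eq_one (ellipseRadius_pos he hS).le he

lemma unitDir_ellipsePoint (he : ‖e‖ = 1) (hS : radius S < t) :
    unitDir (ellipsePoint t S e) = e :=
  unitDir_mul_of_norm_eq_one (ellipseRadius_pos he hS) he

lemma eq_ellipsePoint_of_mem {X : Hyp} (hX : X ∈ beachEllipse t S) (hS : radius S < t) :
    X = ellipsePoint t S (unitDir X) := by
  have he := norm_unitDir X
  obtain ⟨h1, h2⟩ := ellipse_ratio_mem he hS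
  rw [← radius_mul_unitDir X, mem_beachEllipse_iff (radius_nonneg X) he] at hX
  rw [ellipsePoint, ellipseRadius]
  have h3 : Real.tanh (radius X) =
      (Real.cosh t - timeCoord S) / (Real.sinh t - dot (spaceCoord S) (unitDir X)) := by
    rw [Real.tanh_eq_sinh_div_cosh, div_eq_div_iff (Real.cosh_pos _).ne' (h1.trans h2).ne', ← hX.2]
  rw [← h3, Real.artanh_tanh, radius_mul_unitDir]

end ellipsePoint

lemma continuousOn_ellipsePoint {S : Hyp} {s : Set ℝ} {e : ℝ → ℂ} (he : ContinuousOn e s)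
    (hn : ∀ t ∈ s, ‖e t‖ = 1) (hS : ∀ t ∈ s, radius S < t) :
    ContinuousOn (fun t => ellipsePoint t S (e t)) s := by
  have hre : ContinuousOn (fun t => (e t).re) s := Complex.continuous_re.comp_continuousOn he
  have him : ContinuousOn (fun t => (e t).im) s := Complex.continuous_im.comp_continuousOn he
  have hq : ContinuousOn (fun t => (Real.cosh t - timeCoord S) /
      (Real.sinh t - dot (spaceCoord S) (e t))) s := by
    refine ContinuousOn.div ?_ ?_ fun t ht => ?_
    · exact (Real.continuous_cosh.sub continuous_const).continuousOn
    · unfold dot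
      exact Real.continuous_sinh.continuousOn.sub
        ((continuousOn_const.mul hre).add (continuousOn_const.mul him))
    · obtain ⟨h1, h2⟩ := ellipse_ratio_mem (hn t ht) (hS t ht)
      exact (h1.trans h2).ne'
  refine ContinuousOn.mul ?_ he
  refine Complex.continuous_ofReal.comp_continuousOn ?_
  unfold ellipseRadius Real.artanh
  have hpos : ∀ t ∈ s, 0 < 1 - (Real.cosh t - timeCoord S) /
      (Real.sinh t - dot (spaceCoord S) (e t)) := fun t ht =>
    sub_pos.2 (ratio_mem_Ioo (hn t ht) (hS t ht)).2
  have hpos' : ∀ t ∈ s, 0 < (Real.cosh t - timeCoord S) /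
      (Real.sinh t - dot (spaceCoord S) (e t)) := fun t ht =>
    (ratio_mem_Ioo (hn t ht) (hS t ht)).1
  refine ContinuousOn.log ?_ fun t ht => ?_
  · exact ((continuousOn_const.add hq).div (continuousOn_const.sub hq)
      fun t ht => (hpos t ht).ne').sqrt
  · have := hpos t ht
    have := hpos' t ht
    positivity

/-! ### Comparing two beach ellipses -/

/-- The constant coefficient of the comparison function of two beach ellipses. -/
noncomputable def gapConst (S T : Hyp) (t : ℝ) : ℝ := Real.sinh t * (timeCoord S - timeCoord T)

/-- The linear coefficient of the comparison function of two beach ellipses. -/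
noncomputable def gapVec (S T : Hyp) (t : ℝ) : ℂ :=
  ((Real.cosh t - timeCoord S : ℝ) : ℂ) * spaceCoord T -
    ((Real.cosh t - timeCoord T : ℝ) : ℂ) * spaceCoord S

/-- The comparison function of the beach ellipses of `S` and `T` in direction `e`: it is negative
if the one of `S` is further out, and zero if they meet. -/
noncomputable def gap (S T : Hyp) (t : ℝ) (e : ℂ) : ℝ := gapConst S T t + dot (gapVec S T t) e

/-- The discriminant of the comparison function. -/
noncomputable def gapDisc (S T : Hyp) (t : ℝ) : ℝ :=
  2 * (timeCoord S * timeCoord T - dot (spaceCoord S) (spaceCoord T) - 1) *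
    (Real.cosh t - timeCoord S) * (Real.cosh t - timeCoord T)

lemma dot_gapVec (S T : Hyp) (t : ℝ) (e : ℂ) : dot (gapVec S T t) e =
    (Real.cosh t - timeCoord S) * dot (spaceCoord T) e -
      (Real.cosh t - timeCoord T) * dot (spaceCoord S) e := by
  simp only [gapVec, dot, Complex.sub_re, Complex.sub_im, Complex.re_ofReal_mul,
    Complex.im_ofReal_mul]
  ring

lemma gap_eq (S T : Hyp) (t : ℝ) (e : ℂ) : gap S T t e =
    (Real.sinh t - dot (spaceCoord S) e) * (Real.cosh t - timeCoord T) -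
      (Real.sinh t - dot (spaceCoord T) e) * (Real.cosh t - timeCoord S) := by
  rw [gap, dot_gapVec, gapConst]; ring

/-- By Pythagoras in the orthonormal frame `e`, `I * e`, this identity says that at a zero `e` of
the gap the squared slope is the discriminant. -/
lemma dot_gapVec_self (S T : Hyp) (t : ℝ) :
    dot (gapVec S T t) (gapVec S T t) = gapConst S T t ^ 2 + gapDisc S T t := by
  have h1 := timeCoord_sq S
  have h2 := timeCoord_sq T
  have h3 := Real.cosh_sq t
  simp only [gapVec, gapConst, gapDisc, dot, Complex.sub_re, Complex.sub_im, Complex.re_ofReal_mul,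
    Complex.im_ofReal_mul]
  generalize Real.cosh t = C at *
  generalize Real.sinh t = D at *
  generalize timeCoord S = p at *
  generalize timeCoord T = q at *
  linear_combination (p - q) ^ 2 * h3 - (C - p) ^ 2 * h2 - (C - q) ^ 2 * h1

lemma gap_rotate {S T : Hyp} {t : ℝ} {e : ℂ} (h : gap S T t e = 0) (x : ℝ) :
    gap S T t (e * Complex.exp ((x : ℂ) * Complex.I)) =
      gapConst S T t * (1 - Real.cos x) +
        dot (gapVec S T t) (Complex.I * e) * Real.sin x := by
  simp only [gap, dot, Complex.mul_re, Complex.mul_im, Complex.I_re, Complex.I_im,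
    Complex.exp_ofReal_mul_I_re, Complex.exp_ofReal_mul_I_im] at h ⊢
  linear_combination Real.cos x * h

lemma slope_sq {S T : Hyp} {t : ℝ} {e : ℂ} (he : ‖e‖ = 1) (h : gap S T t e = 0) :
    dot (gapVec S T t) (Complex.I * e) ^ 2 = gapDisc S T t := by
  have h1 := dot_gapVec_self S T t
  have h2 := sq_add_sq_of_norm_eq_one he
  simp only [gap, dot, Complex.mul_re, Complex.mul_im, Complex.I_re, Complex.I_im] at h h1 ⊢
  generalize (gapVec S T t).re = a at *
  generalize (gapVec S T t).im = b at *
  generalize gapConst S T t = c at *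
  linear_combination (a ^ 2 + b ^ 2) * h2 + h1 + (c - (a * e.re + b * e.im)) * h

lemma gapDisc_nonneg {S T : Hyp} {t : ℝ} (hS : radius S ≤ t) (hT : radius T ≤ t) :
    0 ≤ gapDisc S T t := by
  have h1 := sub_nonneg.2 (timeCoord_le_cosh hS)
  have h2 := sub_nonneg.2 (timeCoord_le_cosh hT)
  have h3 := sub_nonneg.2 ((Real.one_le_cosh _).trans (cosh_radius_sub_le S T))
  unfold gapDisc
  positivity

lemma gapDisc_pos {S T : Hyp} {t : ℝ} (hST : S ≠ T) (hS : radius S < t) (hT : radius T < t) :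
    0 < gapDisc S T t := by
  have h1 := sub_pos.2 (timeCoord_lt_cosh hS)
  have h2 := sub_pos.2 (timeCoord_lt_cosh hT)
  have h3 := sub_pos.2 (one_lt_cosh_hdist hST)
  unfold gapDisc
  positivity

lemma radius_eq_of_gapDisc_eq_zero {S T : Hyp} {t : ℝ} (hST : S ≠ T) (hS : radius S < t)
    (h : gapDisc S T t = 0) : radius T = t := by
  have h1 := sub_pos.2 (timeCoord_lt_cosh hS)
  have h3 := sub_pos.2 (one_lt_cosh_hdist hST)
  have h4 : Real.cosh t - timeCoord T = 0 :=
    (mul_eq_zero.1 h).resolve_left (by positivity)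
  exact radius_eq_of_timeCoord_eq ((radius_nonneg S).trans hS.le) (by linarith)

/-- When T is on the sweep circle its ellipse collapses to a segment. The gap is then never
positive, and for S strictly inside the circle it vanishes only in the direction of T. -/
lemma gap_of_radius_eq {S T : Hyp} {t : ℝ} (hT : radius T = t) (e : ℂ) :
    gap S T t e = (Real.cosh t - timeCoord S) * (dot (spaceCoord T) e - Real.sinh t) := by
  rw [gap_eq, show timeCoord T = Real.cosh t by rw [timeCoord, hT]]; ring

lemma gap_nonpos_of_radius_eq {S T : Hyp} {t : ℝ} (hS : radius S ≤ t) (hT : radius T = t) {e : ℂ}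
    (he : ‖e‖ = 1) : gap S T t e ≤ 0 := by
  rw [gap_of_radius_eq hT]
  have h := dot_spaceCoord_le T he
  rw [hT] at h
  exact mul_nonpos_of_nonneg_of_nonpos (sub_nonneg.2 (timeCoord_le_cosh hS)) (by linarith)

lemma eq_unitDir_of_gap_eq_zero {S T : Hyp} {t : ℝ} (hS : radius S < t) (hT : radius T = t) {e : ℂ}
    (he : ‖e‖ = 1) (h : gap S T t e = 0) : unitDir T = e := by
  have ht : 0 < t := (radius_nonneg S).trans_lt hS
  rw [gap_of_radius_eq hT] at h
  have h1 := (mul_eq_zero.1 h).resolve_left (sub_pos.2 (timeCoord_lt_cosh hS)).ne'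
  rw [spaceCoord, dot_ofReal_mul_left, hT] at h1
  have h2 : 0 < Real.sinh t := Real.sinh_pos_iff.2 ht
  refine eq_of_one_le_dot (norm_unitDir T) he ?_
  by_contra hlt
  push Not at hlt
  nlinarith

/-- A site that has just been reached by the sweep circle is on the beach curve. -/
lemma gap_unitDir_pos {S T : Hyp} {t : ℝ} (hST : radius S < radius T) (hT : radius T < t) :
    0 < gap S T t (unitDir T) := by
  have h1 := dot_spaceCoord_le S (norm_unitDir T)
  have hS0 := radius_nonneg S
  rw [gap_eq, dot_spaceCoord_unitDir_self, timeCoord, timeCoord]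
  generalize dot (spaceCoord S) (unitDir T) = a at *
  generalize radius S = p at *
  generalize radius T = q at *
  -- Half difference and half sum, for sum-to-product formulas. After the factor 2 sinh u is
  -- removed, the claim reduces to cosh (m - p) > cosh u, which holds because m - u = q > p.
  obtain ⟨u, hu⟩ : ∃ u, u = (t - q) / 2 := ⟨_, rfl⟩
  obtain ⟨m, hm⟩ : ∃ m, m = (t + q) / 2 := ⟨_, rfl⟩
  have ht : t = m + u := by rw [hu, hm]; ring
  have hq : q = m - u := by rw [hu, hm]; ring
  have e1 : Real.cosh t - Real.cosh q = 2 * Real.sinh m * Real.sinh u := by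
    rw [ht, hq, Real.cosh_add, Real.cosh_sub]; ring
  have e2 : Real.sinh t - Real.sinh q = 2 * Real.cosh m * Real.sinh u := by
    rw [ht, hq, Real.sinh_add, Real.sinh_sub]; ring
  have e3 : Real.sinh t * Real.cosh q - Real.cosh t * Real.sinh q =
      2 * Real.sinh u * Real.cosh u := by
    rw [← Real.sinh_sub, ← Real.sinh_two_mul]; congr 1; rw [hu]; ring
  have hu0 : 0 < Real.sinh u := Real.sinh_pos_iff.2 (by linarith)
  have hm0 : 0 < Real.sinh m := Real.sinh_pos_iff.2 (by linarith)
  have h5 : Real.cosh u < Real.cosh (m - p) := by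
    rw [Real.cosh_lt_cosh, abs_of_nonneg (by linarith), abs_of_nonneg (by linarith)]; linarith
  rw [Real.cosh_sub] at h5
  have h6 : (Real.sinh t - a) * (Real.cosh t - Real.cosh q) -
      (Real.sinh t - Real.sinh q) * (Real.cosh t - Real.cosh p) =
      2 * Real.sinh u * (Real.cosh m * Real.cosh p - a * Real.sinh m - Real.cosh u) := by
    linear_combination (-a) * e1 + Real.cosh p * e2 - e3
  rw [h6]
  have h7 : 0 < Real.cosh m * Real.cosh p - a * Real.sinh m - Real.cosh u := by nlinarith
  positivity

/-- The comparison function in terms of distances. -/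
lemma gap_mul_sinh {S T : Hyp} {t : ℝ} {e : ℂ} (he : ‖e‖ = 1) (hS : radius S < t) :
    gap S T t e * Real.sinh (ellipseRadius t S e) = (Real.cosh t - timeCoord S) *
      (Real.cosh (t - ellipseRadius t S e) - Real.cosh (hdist (ellipsePoint t S e) T)) := by
  have hρ := ellipseRadius_pos he hS
  have h := ellipseRadius_spec he hS
  have hcomm : dot e (spaceCoord T) = dot (spaceCoord T) e := by simp only [dot]; ring
  rw [cosh_hdist, ellipsePoint, timeCoord_mul hρ.le he, spaceCoord_mul hρ.le he,
    dot_ofReal_mul_left, Real.cosh_sub, hcomm, gap_eq]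
  linear_combination (-(Real.cosh t - timeCoord T)) * h

section

variable {S T : Hyp} {t : ℝ} {e : ℂ}

lemma le_hdist_of_gap_nonpos (he : ‖e‖ = 1) (hS : radius S < t) (h : gap S T t e ≤ 0) :
    t - ellipseRadius t S e ≤ hdist (ellipsePoint t S e) T := by
  have h1 := gap_mul_sinh (T := T) he hS
  have h2 := sub_pos.2 (timeCoord_lt_cosh hS)
  have h3 : 0 < Real.sinh (ellipseRadius t S e) := Real.sinh_pos_iff.2 (ellipseRadius_pos he hS)
  have h4 : Real.cosh (t - ellipseRadius t S e) ≤ Real.cosh (hdist (ellipsePoint t S e) T) := by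
    by_contra hlt
    push Not at hlt
    nlinarith [mul_pos h2 (sub_pos.2 hlt)]
  rwa [Real.cosh_le_cosh, abs_of_nonneg (sub_nonneg.2 (ellipseRadius_le he hS)),
    abs_of_nonneg (hdist_nonneg _ _)] at h4

lemma mem_beachEllipse_of_gap_eq_zero (he : ‖e‖ = 1) (hS : radius S < t) (h : gap S T t e = 0) :
    ellipsePoint t S e ∈ beachEllipse t T := by
  have h1 := gap_mul_sinh (T := T) he hS
  have h2 := sub_pos.2 (timeCoord_lt_cosh hS)
  rw [h, zero_mul, eq_comm, mul_eq_zero, or_iff_right h2.ne', sub_eq_zero] at h1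
  rw [beachEllipse, Set.mem_ofPred_eq, radius_ellipsePoint he hS]
  exact Real.cosh_injOn (hdist_nonneg _ _) (sub_nonneg.2 (ellipseRadius_le he hS)) h1.symm

lemma gap_eq_zero_of_mem (he : ‖e‖ = 1) (hS : radius S < t)
    (h : ellipsePoint t S e ∈ beachEllipse t T) : gap S T t e = 0 := by
  have h1 := gap_mul_sinh (T := T) he hS
  rw [beachEllipse, Set.mem_ofPred_eq, radius_ellipsePoint he hS] at h
  rw [h, sub_self, mul_zero] at h1
  exact (mul_eq_zero.1 h1).resolve_right (Real.sinh_pos_iff.2 (ellipseRadius_pos he hS)).ne'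

lemma gap_neg_of_lt_hdist (he : ‖e‖ = 1) (hS : radius S < t)
    (h : t - ellipseRadius t S e < hdist (ellipsePoint t S e) T) : gap S T t e < 0 := by
  have h1 := gap_mul_sinh (T := T) he hS
  have h2 := sub_pos.2 (timeCoord_lt_cosh hS)
  have h3 : 0 < Real.sinh (ellipseRadius t S e) := Real.sinh_pos_iff.2 (ellipseRadius_pos he hS)
  have h4 : Real.cosh (t - ellipseRadius t S e) < Real.cosh (hdist (ellipsePoint t S e) T) := by
    rwa [Real.cosh_lt_cosh, abs_of_nonneg (sub_nonneg.2 (ellipseRadius_le he hS)),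
      abs_of_nonneg (hdist_nonneg _ _)]
  by_contra hlt
  push Not at hlt
  nlinarith [mul_pos h2 (sub_pos.2 h4), mul_nonneg hlt h3.le]

/-- Where the comparison function is nonpositive, the beach ellipse of `T` is inside the one of
`S`, except for the ray on which `T` is on the sweep circle. -/
lemma radius_le_of_gap_nonpos {X : Hyp} (hS : radius S < t) (hT : radius T ≤ t)
    (h : gap S T t (unitDir X) ≤ 0) (hX : X ∈ beachEllipse t T)
    (hne : ¬ (radius T = t ∧ unitDir T = unitDir X)) :
    radius X ≤ ellipseRadius t S (unitDir X) := by
  have he := norm_unitDir X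
  by_contra hlt
  push Not at hlt
  have hρ := ellipseRadius_pos he hS
  have hs := ellipseRadius_spec he hS
  rw [← radius_mul_unitDir X, mem_beachEllipse_iff (radius_nonneg X) he] at hX
  have hX2 := hX.2
  have hx := sub_pos.2 (timeCoord_lt_cosh hS)
  have hsX : 0 < Real.sinh (radius X) := Real.sinh_pos_iff.2 (hρ.trans hlt)
  have hsρ : 0 < Real.sinh (ellipseRadius t S (unitDir X)) := Real.sinh_pos_iff.2 hρ
  -- Eliminating between the two ellipse equations makes the gap proportional to the sinh of the
  -- difference of radii.
  have hkey : gap S T t (unitDir X) *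
      (Real.sinh (radius X) * Real.sinh (ellipseRadius t S (unitDir X))) =
      (Real.cosh t - timeCoord S) * (Real.cosh t - timeCoord T) *
        Real.sinh (radius X - ellipseRadius t S (unitDir X)) := by
    rw [gap_eq, Real.sinh_sub]
    linear_combination (Real.cosh t - timeCoord S) *
      Real.sinh (ellipseRadius t S (unitDir X)) * hX2 -
      (Real.cosh t - timeCoord T) * Real.sinh (radius X) * hs
  have hd : 0 < Real.sinh (radius X - ellipseRadius t S (unitDir X)) :=
    Real.sinh_pos_iff.2 (by linarith)
  have hle : gap S T t (unitDir X) *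
      (Real.sinh (radius X) * Real.sinh (ellipseRadius t S (unitDir X))) ≤ 0 :=
    mul_nonpos_of_nonpos_of_nonneg h (mul_pos hsX hsρ).le
  rcases hT.lt_or_eq with hT | hT
  · have := mul_pos (mul_pos hx (sub_pos.2 (timeCoord_lt_cosh hT))) hd
    linarith
  · rw [show timeCoord T = Real.cosh t by rw [timeCoord, hT], sub_self, mul_zero, zero_mul] at hkey
    exact hne ⟨hT, eq_unitDir_of_gap_eq_zero hS hT he
      ((mul_eq_zero.1 hkey).resolve_right (mul_pos hsX hsρ).ne')⟩

lemma radius_lt_of_gap_neg {X : Hyp} (hS : radius S < t) (hT : radius T ≤ t)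
    (h : gap S T t (unitDir X) < 0) (hX : X ∈ beachEllipse t T) :
    radius X < ellipseRadius t S (unitDir X) := by
  have he := norm_unitDir X
  refine lt_of_le_of_ne (radius_le_of_gap_nonpos hS hT h.le hX ?_) fun heq => ?_
  · rintro ⟨h1, h2⟩
    rw [gap_of_radius_eq h1, ← h2, dot_spaceCoord_unitDir_self, h1, sub_self, mul_zero] at h
    exact lt_irrefl _ h
  · have : X = ellipsePoint t S (unitDir X) := by
      rw [ellipsePoint, ← heq, radius_mul_unitDir]
    rw [this] at hX
    rw [gap_eq_zero_of_mem he hS hX] at h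
    exact lt_irrefl _ h

end

/-! ### Points of the beach curve -/

/-- A point of the beach ellipse of `S` that no other beach ellipse surpasses is on the beach
curve. -/
lemma ellipsePoint_mem_beachCurve {𝒮 : Finset Hyp} {S : Hyp} {t : ℝ} {e : ℂ} (hS : S ∈ 𝒮)
    (he : ‖e‖ = 1) (hSt : radius S < t)
    (h : ∀ T ∈ 𝒮, radius T ≤ t → T ≠ S → gap S T t e ≤ 0) :
    ellipsePoint t S e ∈ beachCurve 𝒮 t := by
  have hdir := unitDir_ellipsePoint he hSt
  have hdirX : ∀ X : Hyp, angle (ellipsePoint t S e) = angle X → unitDir X = e := fun X hX => by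
    rw [← hdir, unitDir, unitDir, hX]
  have hrad := radius_ellipsePoint he hSt
  have hlow : ∀ T ∈ 𝒮, radius T ≤ t → ¬ (radius T = t ∧ unitDir T = e) → T ≠ S → ∀ X : Hyp,
      X ∈ beachEllipse t T → angle (ellipsePoint t S e) = angle X →
      radius X ≤ radius (ellipsePoint t S e) := fun T hT hTt hne hTS X hX hang => by
    have hXe := hdirX X hang
    have := radius_le_of_gap_nonpos (X := X) hSt hTt (by rw [hXe]; exact h T hT hTt hTS) hX
      (by rwa [hXe])
    rwa [hXe, ← hrad] at this
  simp only [beachCurve, Set.mem_iUnion]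
  -- A site on the sweep circle in this very direction has a segment reaching beyond the point. The
  -- point then lies in the active part of that site, since a segment does not obstruct itself.
  by_cases hex : ∃ T ∈ 𝒮, radius T = t ∧ unitDir T = e
  · obtain ⟨T, hT, hTt, hTe⟩ := hex
    refine ⟨T, ⟨hT, hTt.le⟩, ?_, ?_⟩
    · apply mem_beachEllipse_of_gap_eq_zero he hSt
      rw [gap_of_radius_eq hTt, ← hTe, dot_spaceCoord_unitDir_self, hTt, sub_self, mul_zero]
    · rintro ⟨U, hU, hUT, X, hX, hang, hlt⟩
      refine absurd hlt (not_lt.2 ?_)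
      by_cases hUS : U = S
      · rw [hUS] at hX
        rw [eq_ellipsePoint_of_mem hX hSt, hdirX X hang]
      · refine hlow U hU.1 hU.2 ?_ hUS X hX hang
        rintro ⟨h1, h2⟩
        apply hUT
        rw [← radius_mul_unitDir U, ← radius_mul_unitDir T, h1, h2, hTt, hTe]
  · push Not at hex
    refine ⟨S, ⟨hS, hSt.le⟩, ellipsePoint_mem he hSt, ?_⟩
    rintro ⟨U, hU, hUS, X, hX, hang, hlt⟩
    exact absurd hlt (not_lt.2 (hlow U hU.1 hU.2 (fun h => hex U hU.1 h.1 h.2) hUS X hX hang))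

/-- Where the beach ellipse of `S` strictly surpasses all others, it is the beach curve. -/
lemma mem_activePart_of_gap_neg {𝒮 : Finset Hyp} {S X : Hyp} {t : ℝ} (hS : S ∈ 𝒮)
    (hSt : radius S < t) (h : ∀ T ∈ 𝒮, radius T ≤ t → T ≠ S → gap S T t (unitDir X) < 0)
    (hX : X ∈ beachCurve 𝒮 t) : X ∈ activePart 𝒮 t S := by
  simp only [beachCurve, Set.mem_iUnion] at hX
  obtain ⟨T, hT, hXT⟩ := hX
  by_cases hTS : T = S
  · rwa [hTS] at hXT
  · exfalso
    have he := norm_unitDir X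
    refine hXT.2 ⟨S, ⟨hS, hSt.le⟩, fun h => hTS h.symm, _, ellipsePoint_mem he hSt,
      (angle_mul_unitDir (ellipseRadius_pos he hSt) X).symm, ?_⟩
    rw [radius_ellipsePoint he hSt]
    exact radius_lt_of_gap_neg hSt hT.2 (h T hT.1 hT.2 hTS) hXT.1

lemma not_mem_beachIntersections_of_gap_neg {𝒮 : Finset Hyp} {S X : Hyp} {t : ℝ} (hS : S ∈ 𝒮)
    (hSt : radius S < t) (h : ∀ T ∈ 𝒮, radius T ≤ t → T ≠ S → gap S T t (unitDir X) < 0) :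
    X ∉ beachIntersections 𝒮 t := by
  rintro ⟨hX, A, hA, B, hB, hAB, hXA, hXB⟩
  have hXS := (mem_activePart_of_gap_neg hS hSt h hX).1
  have hne : ∀ T ∈ seenSites 𝒮 t, T ≠ S → X ∉ beachEllipse t T := fun T hT hTS hXT => by
    have h1 := radius_lt_of_gap_neg hSt hT.2 (h T hT.1 hT.2 hTS) hXT
    have h2 := congrArg radius (eq_ellipsePoint_of_mem hXS hSt)
    rw [radius_ellipsePoint (norm_unitDir X) hSt] at h2
    exact h1.ne h2
  by_cases hAS : A = S
  · exact hne B hB (fun h => hAB (hAS.trans h.symm)) hXB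
  · exact hne A hA hAS hXA

/-! ### The moving intersections -/

/-- The direction of one of the two intersections of the beach ellipses of `S` and `T`. -/
noncomputable def meetDir (S T : Hyp) (ε t : ℝ) : ℂ :=
  gapVec S T t * ⟨-gapConst S T t, ε * √(gapDisc S T t)⟩ /
    ((dot (gapVec S T t) (gapVec S T t) : ℝ) : ℂ)

/-- At the moment T is reached the discriminant vanishes but the constant coefficient does not, so
`meetDir` stays continuous up to that moment. -/
lemma dot_gapVec_self_pos {S T : Hyp} {t : ℝ} (hST : S ≠ T) (hS : radius S < t)
    (hT : radius T ≤ t) : 0 < dot (gapVec S T t) (gapVec S T t) := by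
  rw [dot_gapVec_self]
  rcases hT.lt_or_eq with hT | hT
  · have := gapDisc_pos hST hS hT
    positivity
  · have h1 := gapDisc_nonneg hS.le hT.le
    have h2 : gapConst S T t ≠ 0 := by
      have h3 := timeCoord_lt_cosh hS
      rw [gapConst, show timeCoord T = Real.cosh t by rw [timeCoord, hT]]
      exact mul_ne_zero (Real.sinh_pos_iff.2 ((radius_nonneg S).trans_lt hS)).ne' (by linarith)
    positivity

lemma dot_mul_self_div {B : ℂ} (hB : dot B B ≠ 0) (z : ℂ) :
    dot B (B * z / ((dot B B : ℝ) : ℂ)) = z.re := by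
  rw [div_eq_mul_inv, ← Complex.ofReal_inv, mul_comm _ (Complex.ofReal _), dot_ofReal_mul_right,
    inv_mul_eq_iff_eq_mul₀ hB]
  simp only [dot, Complex.mul_re, Complex.mul_im]
  ring

lemma dot_I_mul_self_div {B : ℂ} (hB : dot B B ≠ 0) (z : ℂ) :
    dot B (Complex.I * (B * z / ((dot B B : ℝ) : ℂ))) = -z.im := by
  have h : Complex.I * (B * z / ((dot B B : ℝ) : ℂ)) =
      B * (Complex.I * z) / ((dot B B : ℝ) : ℂ) := by ring
  rw [h, dot_mul_self_div hB]
  simp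

section meetDir

variable {S T : Hyp} {t ε : ℝ}

lemma gap_meetDir (hST : S ≠ T) (hS : radius S < t) (hT : radius T ≤ t) :
    gap S T t (meetDir S T ε t) = 0 := by
  rw [gap, meetDir, dot_mul_self_div (dot_gapVec_self_pos hST hS hT).ne']
  simp

/-- The sign ε selects the zero: counterclockwise, the ellipse of S emerges from that of T at ε = 1
and goes under it at ε = -1. -/
lemma slope_meetDir (hST : S ≠ T) (hS : radius S < t) (hT : radius T ≤ t) :
    dot (gapVec S T t) (Complex.I * meetDir S T ε t) = -(ε * √(gapDisc S T t)) := by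
  rw [meetDir, dot_I_mul_self_div (dot_gapVec_self_pos hST hS hT).ne']

lemma norm_meetDir (hε : ε ^ 2 = 1) (hST : S ≠ T) (hS : radius S < t) (hT : radius T ≤ t) :
    ‖meetDir S T ε t‖ = 1 := by
  have hpos := dot_gapVec_self_pos hST hS hT
  have h1 : ‖gapVec S T t‖ ^ 2 = dot (gapVec S T t) (gapVec S T t) := by
    rw [Complex.sq_norm, Complex.normSq_apply, dot]
  have h2 : ‖(⟨-gapConst S T t, ε * √(gapDisc S T t)⟩ : ℂ)‖ ^ 2 =
      dot (gapVec S T t) (gapVec S T t) := by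
    rw [Complex.sq_norm, Complex.normSq_apply, dot_gapVec_self]
    simp only
    linear_combination ε ^ 2 * Real.sq_sqrt (gapDisc_nonneg hS.le hT) + gapDisc S T t * hε
  have h3 : ‖meetDir S T ε t‖ ^ 2 = 1 := by
    rw [meetDir, norm_div, norm_mul, Complex.norm_real, Real.norm_of_nonneg hpos.le, div_pow,
      mul_pow, h1, h2, div_eq_one_iff_eq (by positivity)]
    ring
  nlinarith [norm_nonneg (meetDir S T ε t)]

lemma eq_meetDir {e : ℂ} (hST : S ≠ T) (hS : radius S < t) (hT : radius T ≤ t)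
    (he : gap S T t e = 0) (hs : dot (gapVec S T t) (Complex.I * e) = -(ε * √(gapDisc S T t))) :
    e = meetDir S T ε t := by
  have hpos := dot_gapVec_self_pos hST hS hT
  have h1 := gap_meetDir (ε := ε) hST hS hT
  have h2 := slope_meetDir (ε := ε) hST hS hT
  rw [gap] at he h1
  replace h1 := he.trans h1.symm
  replace h2 := hs.trans h2.symm
  simp only [dot, Complex.mul_re, Complex.mul_im, Complex.I_re, Complex.I_im] at h1 h2 hpos
  generalize (gapVec S T t).re = a at *
  generalize (gapVec S T t).im = b at *
  apply Complex.ext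
  · apply mul_left_cancel₀ hpos.ne'
    linear_combination a * h1 + b * h2
  · apply mul_left_cancel₀ hpos.ne'
    linear_combination b * h1 - a * h2

end meetDir

lemma continuous_gapConst (S T : Hyp) : Continuous (gapConst S T) :=
  Real.continuous_sinh.mul continuous_const

lemma continuous_gapDisc (S T : Hyp) : Continuous (gapDisc S T) := by
  unfold gapDisc
  have := Real.continuous_cosh
  fun_prop

lemma continuous_gapVec (S T : Hyp) : Continuous (gapVec S T) := by
  unfold gapVec
  have := Real.continuous_cosh
  fun_prop

lemma continuous_dot : Continuous fun p : ℂ × ℂ => dot p.1 p.2 := by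
  unfold dot
  fun_prop

lemma continuous_gap (S T : Hyp) : Continuous fun p : ℝ × ℂ => gap S T p.1 p.2 :=
  ((continuous_gapConst S T).comp continuous_fst).add
    (continuous_dot.comp (((continuous_gapVec S T).comp continuous_fst).prodMk continuous_snd))

lemma continuousOn_meetDir {S T : Hyp} {ε : ℝ} {s : Set ℝ} (hST : S ≠ T)
    (hS : ∀ t ∈ s, radius S < t) (hT : ∀ t ∈ s, radius T ≤ t) :
    ContinuousOn (meetDir S T ε) s := by
  have h : ContinuousOn (fun t => gapVec S T t * (((-gapConst S T t : ℝ) : ℂ) +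
      ((ε * √(gapDisc S T t) : ℝ) : ℂ) * Complex.I) /
        ((dot (gapVec S T t) (gapVec S T t) : ℝ) : ℂ)) s := by
    refine ContinuousOn.div (Continuous.continuousOn ?_) (Continuous.continuousOn ?_) fun t ht => ?_
    · have h1 := continuous_gapConst S T
      have h2 := continuous_gapDisc S T
      have h3 := continuous_gapVec S T
      fun_prop
    · exact Complex.continuous_ofReal.comp (continuous_dot.comp
        ((continuous_gapVec S T).prodMk (continuous_gapVec S T)))
    · exact_mod_cast (dot_gapVec_self_pos hST (hS t ht) (hT t ht)).ne'
  refine h.congr fun t _ => ?_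
  rw [meetDir, Complex.mk_eq_add_mul_I]

/-! ### Angles between directions -/

/-- The angle, in `[0, 2π)`, from the direction `e` to the direction `f`. -/
noncomputable def turn (e f : ℂ) : ℝ := mod2pi (Complex.arg (f * starRingEnd ℂ e))

lemma turn_nonneg (e f : ℂ) : 0 ≤ turn e f := mod2pi_nonneg _

lemma turn_lt (e f : ℂ) : turn e f < 2 * Real.pi := mod2pi_lt _

lemma mul_conj_of_norm_eq_one {e : ℂ} (he : ‖e‖ = 1) : e * starRingEnd ℂ e = 1 := by
  rw [Complex.mul_conj']; simp [he]

lemma norm_mul_conj {e f : ℂ} (he : ‖e‖ = 1) (hf : ‖f‖ = 1) : ‖f * starRingEnd ℂ e‖ = 1 := by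
  rw [norm_mul, RCLike.norm_conj, he, hf, mul_one]

lemma exp_turn {e f : ℂ} (he : ‖e‖ = 1) (hf : ‖f‖ = 1) :
    Complex.exp ((turn e f : ℂ) * Complex.I) = f * starRingEnd ℂ e := by
  have h := Complex.norm_mul_exp_arg_mul_I (f * starRingEnd ℂ e)
  rw [norm_mul_conj he hf, Complex.ofReal_one, one_mul] at h
  rw [turn, exp_mod2pi, h]

lemma mul_exp_turn {e f : ℂ} (he : ‖e‖ = 1) (hf : ‖f‖ = 1) :
    e * Complex.exp ((turn e f : ℂ) * Complex.I) = f := by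
  rw [exp_turn he hf]
  linear_combination f * mul_conj_of_norm_eq_one he

lemma eq_of_exp_eq {x y : ℝ} (hx : 0 ≤ x) (hx' : x < 2 * Real.pi) (hy : 0 ≤ y)
    (hy' : y < 2 * Real.pi)
    (h : Complex.exp ((x : ℂ) * Complex.I) = Complex.exp ((y : ℂ) * Complex.I)) : x = y := by
  obtain ⟨n, hn⟩ := Complex.exp_eq_exp_iff_exists_int.1 h
  have h1 : x = y + n * (2 * Real.pi) := by
    have : (x : ℂ) = ((y + n * (2 * Real.pi) : ℝ) : ℂ) := by
      apply mul_right_cancel₀ Complex.I_ne_zero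
      rw [hn]; push_cast; ring
    exact_mod_cast this
  have hpi := Real.two_pi_pos
  have hn1 : (n : ℝ) < 1 := by nlinarith
  have hn2 : (-1 : ℝ) < n := by nlinarith
  have hn0 : n = 0 := by
    have : n < 1 := by exact_mod_cast hn1
    have : -1 < n := by exact_mod_cast hn2
    omega
  rw [h1, hn0]; simp

lemma ccw_eq_turn (P Q : Hyp) : ccw P Q = turn (unitDir P) (unitDir Q) := by
  refine eq_of_exp_eq (mod2pi_nonneg _) (mod2pi_lt _) (turn_nonneg _ _) (turn_lt _ _) ?_
  rw [exp_turn (norm_unitDir P) (norm_unitDir Q), ccw, exp_mod2pi, unitDir, unitDir,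
    ← Complex.exp_conj, ← Complex.exp_add]
  congr 1
  simp
  ring

lemma turn_pos {e f : ℂ} (he : ‖e‖ = 1) (hf : ‖f‖ = 1) (h : e ≠ f) : 0 < turn e f := by
  refine lt_of_le_of_ne (turn_nonneg e f) fun h0 => h ?_
  have := mul_exp_turn he hf
  rwa [← h0, Complex.ofReal_zero, zero_mul, Complex.exp_zero, mul_one] at this

lemma turn_self {e : ℂ} (he : ‖e‖ = 1) : turn e e = 0 := by
  rw [turn, mul_conj_of_norm_eq_one he, Complex.arg_one, mod2pi, toIcoMod_apply_left]

/-- Negating moves the branch cut to e = f, so `turn` is continuous wherever the two directions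
differ. -/
lemma turn_eq_arg_neg {e f : ℂ} (he : ‖e‖ = 1) (hf : ‖f‖ = 1)
    (h : -(f * starRingEnd ℂ e) ∈ Complex.slitPlane) :
    turn e f = Real.pi + Complex.arg (-(f * starRingEnd ℂ e)) := by
  have h1 := Complex.neg_pi_lt_arg (-(f * starRingEnd ℂ e))
  have h2 := lt_of_le_of_ne (Complex.arg_le_pi (-(f * starRingEnd ℂ e)))
    (Complex.mem_slitPlane_iff_arg.1 h).1
  refine eq_of_exp_eq (turn_nonneg _ _) (turn_lt _ _) (by linarith) (by linarith) ?_
  have h3 := Complex.norm_mul_exp_arg_mul_I (-(f * starRingEnd ℂ e))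
  rw [norm_neg, norm_mul_conj he hf, Complex.ofReal_one, one_mul] at h3
  rw [exp_turn he hf]
  push_cast
  rw [add_mul, Complex.exp_add, h3, Complex.exp_pi_mul_I]
  ring

lemma neg_mem_slitPlane {e f : ℂ} (he : ‖e‖ = 1) (hf : ‖f‖ = 1) (h : e ≠ f) :
    -(f * starRingEnd ℂ e) ∈ Complex.slitPlane := by
  rw [Complex.mem_slitPlane_iff]
  by_contra hcon
  push Not at hcon
  simp only [Complex.neg_re, Complex.neg_im, neg_eq_zero] at hcon
  have hn := sq_add_sq_of_norm_eq_one (norm_mul_conj he hf)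
  have him := hcon.2
  have hre : (f * starRingEnd ℂ e).re = 1 := by
    rw [him] at hn
    nlinarith [hcon.1]
  have h1 : f * starRingEnd ℂ e = 1 := Complex.ext (by rw [hre, Complex.one_re])
    (by rw [him, Complex.one_im])
  apply h
  linear_combination f * mul_conj_of_norm_eq_one he - e * h1

lemma continuousWithinAt_turn {e f : ℝ → ℂ} {s : Set ℝ} {t : ℝ} (he : ∀ t ∈ s, ‖e t‖ = 1)
    (hf : ∀ t ∈ s, ‖f t‖ = 1) (hce : ContinuousWithinAt e s t) (hcf : ContinuousWithinAt f s t)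
    (ht : t ∈ s) (h : e t ≠ f t) : ContinuousWithinAt (fun t => turn (e t) (f t)) s t := by
  have hc : ContinuousWithinAt (fun t => -(f t * starRingEnd ℂ (e t))) s t :=
    (hcf.mul (Complex.continuous_conj.continuousAt.comp_continuousWithinAt hce)).neg
  have hmem := neg_mem_slitPlane (he t ht) (hf t ht) h
  have hev : ∀ᶠ x in 𝓝[s] t, -(f x * starRingEnd ℂ (e x)) ∈ Complex.slitPlane :=
    hc.eventually (Complex.isOpen_slitPlane.mem_nhds hmem)
  have h2 : ContinuousWithinAt
      (fun t => Real.pi + Complex.arg (-(f t * starRingEnd ℂ (e t)))) s t :=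
    continuousWithinAt_const.add
      (ContinuousAt.comp_continuousWithinAt (f := fun t => -(f t * starRingEnd ℂ (e t)))
        (Complex.continuousAt_arg hmem) hc)
  refine h2.congr_of_eventuallyEq ?_ (turn_eq_arg_neg (he t ht) (hf t ht) hmem)
  filter_upwards [hev, self_mem_nhdsWithin] with x hx hxs
  exact turn_eq_arg_neg (he x hxs) (hf x hxs) hx

/-! ### Signs on the arc between the intersections -/

lemma forall_neg_of_exists_neg {s : Set ℝ} (hs : IsPreconnected s) {f : ℝ → ℝ}
    (hf : ContinuousOn f s) (hne : ∀ t ∈ s, f t ≠ 0) {t₀ : ℝ} (ht₀ : t₀ ∈ s) (h : f t₀ < 0) :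
    ∀ t ∈ s, f t < 0 := by
  intro t ht
  by_contra hlt
  push Not at hlt
  obtain ⟨u, hu, hu0⟩ := hs.intermediate_value ht₀ ht hf ⟨h.le, hlt⟩
  exact hne u hu hu0

/-- A function without zeros keeps its sign, so the first expression stays negative from a on. As
cos δ → 1, either δ → 0 or δ is near 2π; in the latter case the first expression would be close to R
b > 0. Hence δ → 0, the second expression tends to -R' b < 0, and its sign propagates back to a. -/
lemma arc_signs {a b : ℝ} (hab : a < b) {δ A R A' R' : ℝ → ℝ} (hδ : ContinuousOn δ (Set.Ico a b))
    (hpos : ∀ t ∈ Set.Ico a b, 0 < δ t) (hlt : ∀ t ∈ Set.Ico a b, δ t < 2 * Real.pi)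
    (hlim : Tendsto (fun t => Real.cos (δ t)) (𝓝[<] b) (𝓝 1))
    (hA : ContinuousOn A (Set.Icc a b)) (hR : ContinuousOn R (Set.Icc a b))
    (hA' : ContinuousOn A' (Set.Icc a b)) (hR' : ContinuousOn R' (Set.Icc a b))
    (hRb : 0 < R b) (hRb' : 0 < R' b)
    (hne : ∀ t ∈ Set.Ico a b, A t * Real.sin (δ t / 2) - R t * Real.cos (δ t / 2) ≠ 0)
    (hne' : ∀ t ∈ Set.Ico a b, A' t * Real.sin (δ t / 2) - R' t * Real.cos (δ t / 2) ≠ 0)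
    (h0 : A a * Real.sin (δ a / 2) - R a * Real.cos (δ a / 2) ≤ 0) :
    (∀ t ∈ Set.Ico a b, A t * Real.sin (δ t / 2) - R t * Real.cos (δ t / 2) < 0) ∧
    (∀ t ∈ Set.Ico a b, A' t * Real.sin (δ t / 2) - R' t * Real.cos (δ t / 2) < 0) ∧
    Tendsto δ (𝓝[<] b) (𝓝 0) := by
  have hmem : Set.Ico a b ∈ 𝓝[<] b := Ico_mem_nhdsLT hab
  have hcont : ∀ {f : ℝ → ℝ}, ContinuousOn f (Set.Icc a b) → Tendsto f (𝓝[<] b) (𝓝 (f b)) :=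
    fun hf => (hf b (Set.right_mem_Icc.2 hab.le)).mono_left
      (nhdsWithin_le_of_mem (mem_of_superset hmem Set.Ico_subset_Icc_self))
  have hcontP : ∀ {f g : ℝ → ℝ}, ContinuousOn f (Set.Icc a b) → ContinuousOn g (Set.Icc a b) →
      ContinuousOn (fun t => f t * Real.sin (δ t / 2) - g t * Real.cos (δ t / 2))
        (Set.Ico a b) := fun hf hg =>
    ((hf.mono Set.Ico_subset_Icc_self).mul
      (Real.continuous_sin.comp_continuousOn (hδ.div_const 2))).sub
    ((hg.mono Set.Ico_subset_Icc_self).mul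
      (Real.continuous_cos.comp_continuousOn (hδ.div_const 2)))
  have ha : a ∈ Set.Ico a b := Set.left_mem_Ico.2 hab
  have hneg := forall_neg_of_exists_neg isPreconnected_Ico (hcontP hA hR) hne ha
    (lt_of_le_of_ne h0 (hne a ha))
  have hsinpos : ∀ t ∈ Set.Ico a b, 0 < Real.sin (δ t / 2) := fun t ht =>
    Real.sin_pos_of_pos_of_lt_pi (by linarith [hpos t ht]) (by linarith [hlt t ht])
  have hsin : Tendsto (fun t => Real.sin (δ t / 2)) (𝓝[<] b) (𝓝 0) := by
    have h1 : Tendsto (fun t => √((1 - Real.cos (δ t)) / 2)) (𝓝[<] b) (𝓝 0) := by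
      have := ((tendsto_const_nhds.sub hlim).div_const 2).sqrt (x := (1 - 1) / 2)
      simpa using this
    refine h1.congr' ?_
    filter_upwards [hmem] with t ht
    have h2 := Real.cos_two_mul (δ t / 2)
    rw [mul_div_cancel₀ _ two_ne_zero] at h2
    rw [h2, show (1 - (2 * Real.cos (δ t / 2) ^ 2 - 1)) / 2 = Real.sin (δ t / 2) ^ 2 by
      rw [Real.sin_sq]; ring, Real.sqrt_sq (hsinpos t ht).le]
  -- Where cos (δ/2) ≤ -1/2, the first expression is at least A sin (δ/2) + R/2, which is positive
  -- near b. Together with sin (δ/2) < 1/2 this forces the cosine to be positive.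
  have hcospos : ∀ᶠ t in 𝓝[<] b, 0 < Real.cos (δ t / 2) := by
    have hAs : Tendsto (fun t => A t * Real.sin (δ t / 2) + R t / 2) (𝓝[<] b)
        (𝓝 (A b * 0 + R b / 2)) := ((hcont hA).mul hsin).add ((hcont hR).div_const 2)
    have e1 := hAs.eventually (lt_mem_nhds (show (0 : ℝ) < A b * 0 + R b / 2 by linarith))
    have e2 := (hcont hR).eventually (lt_mem_nhds hRb)
    have e3 := hsin.eventually (gt_mem_nhds (show (0 : ℝ) < 1 / 2 by norm_num))
    filter_upwards [e1, e2, e3, hmem] with t h1 h2 h3 ht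
    have h4 := hneg t ht
    have h5 := hsinpos t ht
    have h6 := Real.sin_sq_add_cos_sq (δ t / 2)
    have h7 : -(1 / 2) < Real.cos (δ t / 2) := by
      by_contra hcon
      push Not at hcon
      nlinarith
    by_contra hcon
    push Not at hcon
    nlinarith
  have hδ0 : Tendsto δ (𝓝[<] b) (𝓝 0) := by
    have h1 : Tendsto (fun t => 2 * Real.arcsin (Real.sin (δ t / 2))) (𝓝[<] b) (𝓝 0) := by
      have := (Real.continuous_arcsin.tendsto 0).comp hsin
      simpa using this.const_mul 2
    refine h1.congr' ?_
    filter_upwards [hcospos, hmem] with t h2 ht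
    have h3 : δ t / 2 < Real.pi / 2 := by
      by_contra hcon
      push Not at hcon
      have := Real.cos_nonpos_of_pi_div_two_le_of_le hcon (by linarith [hlt t ht, Real.pi_pos])
      linarith
    rw [Real.arcsin_sin (by linarith [hpos t ht, Real.pi_pos]) h3.le]
    ring
  refine ⟨hneg, ?_, hδ0⟩
  have hcos : Tendsto (fun t => Real.cos (δ t / 2)) (𝓝[<] b) (𝓝 1) := by
    have := (Real.continuous_cos.tendsto 0).comp (by simpa using hδ0.div_const 2)
    simpa [Function.comp_def] using this
  have hlim' : Tendsto (fun t => A' t * Real.sin (δ t / 2) - R' t * Real.cos (δ t / 2)) (𝓝[<] b)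
      (𝓝 (A' b * 0 - R' b * 1)) := ((hcont hA').mul hsin).sub ((hcont hR').mul hcos)
  have hev := hlim'.eventually (gt_mem_nhds (show A' b * 0 - R' b * 1 < 0 by linarith))
  have : (𝓝[<] b).NeBot := inferInstance
  obtain ⟨t₀, h1, h2⟩ := (hev.and hmem).exists
  exact forall_neg_of_exists_neg isPreconnected_Ico (hcontP hA' hR') hne' h2 h1

/-- The condition reads A < R cot h, and cot is decreasing on (0, π). -/
lemma arc_neg_of_le {A R h H : ℝ} (hR : 0 ≤ R) (h0 : 0 < h) (hH : h ≤ H) (hHpi : H < Real.pi)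
    (hneg : A * Real.sin H - R * Real.cos H < 0) : A * Real.sin h - R * Real.cos h < 0 := by
  have s1 : 0 < Real.sin h := Real.sin_pos_of_pos_of_lt_pi h0 (by linarith)
  have s2 : 0 < Real.sin H := Real.sin_pos_of_pos_of_lt_pi (by linarith) hHpi
  have s3 : 0 ≤ Real.sin (H - h) := Real.sin_nonneg_of_nonneg_of_le_pi (by linarith) (by linarith)
  rw [Real.sin_sub] at s3
  have key : Real.sin H * (A * Real.sin h - R * Real.cos h) < 0 := by nlinarith
  by_contra hcon
  push Not at hcon
  nlinarith

/-- Splits off the known zero at x = 0 as the factor sin (x / 2), which is positive for 0 < x < 2π;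
the sign is carried by the other factor. -/
lemma gap_rotate_half {S T : Hyp} {t : ℝ} {e : ℂ} {q : ℝ} (h : gap S T t e = 0)
    (hs : dot (gapVec S T t) (Complex.I * e) = -q) (x : ℝ) :
    gap S T t (e * Complex.exp ((x : ℂ) * Complex.I)) = 2 * Real.sin (x / 2) *
      (gapConst S T t * Real.sin (x / 2) - q * Real.cos (x / 2)) := by
  have h1 := Real.cos_two_mul (x / 2)
  have h2 := Real.sin_two_mul (x / 2)
  rw [mul_div_cancel₀ _ two_ne_zero] at h1 h2
  rw [gap_rotate h, hs, h1, h2]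
  linear_combination (-2) * gapConst S T t * Real.sin_sq_add_cos_sq (x / 2)

/-- The directions `e₁` and `e₃` of an intersection of the beach ellipses of `S₁` and `S₂` and of
one of `S₂` and `S₃`, such that on the arc of length `δ` from `e₁` to `e₃` the ellipse of `S₂` is
outside the two others. -/
structure MovingArc (S₁ S₂ S₃ : Hyp) (a b : ℝ) (e₁ e₃ : ℝ → ℂ) (δ : ℝ → ℝ) : Prop where
  continuousOn_fst : ContinuousOn e₁ (Set.Icc a b)
  continuousOn_snd : ContinuousOn e₃ (Set.Icc a b)
  continuousOn_length : ContinuousOn δ (Set.Icc a b)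
  norm_fst : ∀ t ∈ Set.Icc a b, ‖e₁ t‖ = 1
  norm_snd : ∀ t ∈ Set.Icc a b, ‖e₃ t‖ = 1
  length_pos : ∀ t ∈ Set.Ico a b, 0 < δ t
  length_end : δ b = 0
  length_eq : ∀ t ∈ Set.Icc a b, δ t = turn (e₁ t) (e₃ t)
  gap_fst : ∀ t ∈ Set.Icc a b, gap S₂ S₁ t (e₁ t) = 0
  gap_snd : ∀ t ∈ Set.Icc a b, gap S₂ S₃ t (e₃ t) = 0
  neg_fst : ∀ t ∈ Set.Ico a b, ∀ x, 0 < x → x ≤ δ t →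
    gap S₂ S₁ t (e₁ t * Complex.exp ((x : ℂ) * Complex.I)) < 0
  neg_snd : ∀ t ∈ Set.Ico a b, ∀ x, 0 ≤ x → x < δ t →
    gap S₂ S₃ t (e₁ t * Complex.exp ((x : ℂ) * Complex.I)) < 0

lemma MovingArc.mono {S₁ S₂ S₃ : Hyp} {a a' b : ℝ} {e₁ e₃ : ℝ → ℂ} {δ : ℝ → ℝ}
    (h : MovingArc S₁ S₂ S₃ a b e₁ e₃ δ) (ha : a ≤ a') : MovingArc S₁ S₂ S₃ a' b e₁ e₃ δ := by
  have h1 : Set.Icc a' b ⊆ Set.Icc a b := Set.Icc_subset_Icc_left ha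
  have h2 : Set.Ico a' b ⊆ Set.Ico a b := Set.Ico_subset_Ico_left ha
  exact ⟨h.continuousOn_fst.mono h1, h.continuousOn_snd.mono h1, h.continuousOn_length.mono h1,
    fun t ht => h.norm_fst t (h1 ht), fun t ht => h.norm_snd t (h1 ht),
    fun t ht => h.length_pos t (h2 ht), h.length_end, fun t ht => h.length_eq t (h1 ht),
    fun t ht => h.gap_fst t (h1 ht), fun t ht => h.gap_snd t (h1 ht),
    fun t ht => h.neg_fst t (h2 ht), fun t ht => h.neg_snd t (h2 ht)⟩

/-- Each end is the zero whose slope has the sign prescribed at b. `huniq` keeps the ends apart and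
each of them off the third ellipse. Starting when the later of S₁ and S₃ is reached supplies the
initial sign that `arc_signs` needs. -/
theorem exists_movingArc {S₁ S₂ S₃ : Hyp} {a b : ℝ} {v : ℂ} (h21 : S₂ ≠ S₁) (h23 : S₂ ≠ S₃)
    (hab : a < b) (h1 : radius S₁ ≤ a) (h2 : radius S₂ < a) (h3 : radius S₃ ≤ a)
    (ha : radius S₁ = a ∨ radius S₃ = a) (hv : ‖v‖ = 1)
    (hg1 : gap S₂ S₁ b v = 0) (hg3 : gap S₂ S₃ b v = 0)
    (hs1 : dot (gapVec S₂ S₁ b) (Complex.I * v) < 0)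
    (hs3 : 0 < dot (gapVec S₂ S₃ b) (Complex.I * v))
    (huniq : ∀ t ∈ Set.Ico a b, ∀ e : ℂ, ‖e‖ = 1 → gap S₂ S₁ t e = 0 → gap S₂ S₃ t e ≠ 0) :
    ∃ (e₁ e₃ : ℝ → ℂ) (δ : ℝ → ℝ), MovingArc S₁ S₂ S₃ a b e₁ e₃ δ ∧ e₁ b = v ∧ e₃ b = v := by
  have hbb : b ∈ Set.Icc a b := Set.right_mem_Icc.2 hab.le
  have hsub : Set.Ico a b ⊆ Set.Icc a b := Set.Ico_subset_Icc_self
  have r1 : ∀ t ∈ Set.Icc a b, radius S₁ ≤ t := fun t ht => h1.trans ht.1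
  have r2 : ∀ t ∈ Set.Icc a b, radius S₂ < t := fun t ht => h2.trans_le ht.1
  have r3 : ∀ t ∈ Set.Icc a b, radius S₃ ≤ t := fun t ht => h3.trans ht.1
  have hc1 : ContinuousOn (meetDir S₂ S₁ 1) (Set.Icc a b) := continuousOn_meetDir h21 r2 r1
  have hc3 : ContinuousOn (meetDir S₂ S₃ (-1)) (Set.Icc a b) := continuousOn_meetDir h23 r2 r3
  have n1 : ∀ t ∈ Set.Icc a b, ‖meetDir S₂ S₁ 1 t‖ = 1 := fun t ht =>
    norm_meetDir (by norm_num) h21 (r2 t ht) (r1 t ht)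
  have n3 : ∀ t ∈ Set.Icc a b, ‖meetDir S₂ S₃ (-1) t‖ = 1 := fun t ht =>
    norm_meetDir (by norm_num) h23 (r2 t ht) (r3 t ht)
  have g1 : ∀ t ∈ Set.Icc a b, gap S₂ S₁ t (meetDir S₂ S₁ 1 t) = 0 := fun t ht =>
    gap_meetDir h21 (r2 t ht) (r1 t ht)
  have g3 : ∀ t ∈ Set.Icc a b, gap S₂ S₃ t (meetDir S₂ S₃ (-1) t) = 0 := fun t ht =>
    gap_meetDir h23 (r2 t ht) (r3 t ht)
  have e1b : meetDir S₂ S₁ 1 b = v := by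
    refine (eq_meetDir h21 (r2 b hbb) (r1 b hbb) hg1 ?_).symm
    rw [← slope_sq hv hg1, Real.sqrt_sq_eq_abs, abs_of_neg hs1]; ring
  have e3b : meetDir S₂ S₃ (-1) b = v := by
    refine (eq_meetDir h23 (r2 b hbb) (r3 b hbb) hg3 ?_).symm
    rw [← slope_sq hv hg3, Real.sqrt_sq_eq_abs, abs_of_pos hs3]; ring
  have d1 : 0 < √(gapDisc S₂ S₁ b) := by
    rw [← slope_sq hv hg1, Real.sqrt_sq_eq_abs]; exact abs_pos.2 hs1.ne
  have d3 : 0 < √(gapDisc S₂ S₃ b) := by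
    rw [← slope_sq hv hg3, Real.sqrt_sq_eq_abs]; exact abs_pos.2 hs3.ne'
  have hne : ∀ t ∈ Set.Ico a b, meetDir S₂ S₁ 1 t ≠ meetDir S₂ S₃ (-1) t := fun t ht heq =>
    huniq t ht _ (n1 t (hsub ht)) (g1 t (hsub ht)) (by rw [heq]; exact g3 t (hsub ht))
  set e₁ := meetDir S₂ S₁ 1 with he₁
  set e₃ := meetDir S₂ S₃ (-1) with he₃
  set δ : ℝ → ℝ := fun t => turn (e₁ t) (e₃ t) with hδ
  have hrot : ∀ t ∈ Set.Icc a b, e₁ t * Complex.exp ((δ t : ℂ) * Complex.I) = e₃ t :=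
    fun t ht => mul_exp_turn (n1 t ht) (n3 t ht)
  have hδpos : ∀ t ∈ Set.Ico a b, 0 < δ t := fun t ht =>
    turn_pos (n1 t (hsub ht)) (n3 t (hsub ht)) (hne t ht)
  have hδlt : ∀ t ∈ Set.Ico a b, δ t < 2 * Real.pi := fun t _ => turn_lt _ _
  have hδcont : ContinuousOn δ (Set.Ico a b) := fun t ht =>
    continuousWithinAt_turn (fun t ht => n1 t (hsub ht)) (fun t ht => n3 t (hsub ht))
      ((hc1 t (hsub ht)).mono hsub) ((hc3 t (hsub ht)).mono hsub) ht (hne t ht)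
  have half1 : ∀ t ∈ Set.Icc a b, ∀ x : ℝ,
      gap S₂ S₁ t (e₁ t * Complex.exp ((x : ℂ) * Complex.I)) = 2 * Real.sin (x / 2) *
        (gapConst S₂ S₁ t * Real.sin (x / 2) - √(gapDisc S₂ S₁ t) * Real.cos (x / 2)) :=
    fun t ht x => gap_rotate_half (g1 t ht)
      (by rw [he₁, slope_meetDir h21 (r2 t ht) (r1 t ht)]; ring) x
  have half3 : ∀ t ∈ Set.Icc a b, ∀ x : ℝ,
      gap S₂ S₃ t (e₁ t * Complex.exp ((x : ℂ) * Complex.I)) = 2 * Real.sin ((δ t - x) / 2) *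
        (gapConst S₂ S₃ t * Real.sin ((δ t - x) / 2) -
          √(gapDisc S₂ S₃ t) * Real.cos ((δ t - x) / 2)) := fun t ht x => by
    -- The comparison with S₃ is known at `e₃ t`, so the arc is measured backwards from that end.
    have h := gap_rotate_half (q := -√(gapDisc S₂ S₃ t)) (g3 t ht)
      (by rw [he₃, slope_meetDir h23 (r2 t ht) (r3 t ht)]; ring) (-(δ t - x))
    have hrw : e₃ t * Complex.exp (((-(δ t - x) : ℝ) : ℂ) * Complex.I) =
        e₁ t * Complex.exp ((x : ℂ) * Complex.I) := by
      rw [← hrot t ht, mul_assoc, ← Complex.exp_add]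
      congr 2
      push_cast
      ring
    rw [← hrw, h, neg_div, Real.sin_neg, Real.cos_neg]
    ring
  have hsinpos : ∀ t ∈ Set.Ico a b, 0 < Real.sin (δ t / 2) := fun t ht =>
    Real.sin_pos_of_pos_of_lt_pi (by linarith [hδpos t ht]) (by linarith [hδlt t ht])
  have key1 : ∀ t ∈ Set.Ico a b, gap S₂ S₁ t (e₃ t) = 2 * Real.sin (δ t / 2) *
      (gapConst S₂ S₁ t * Real.sin (δ t / 2) - √(gapDisc S₂ S₁ t) * Real.cos (δ t / 2)) :=
    fun t ht => by rw [← hrot t (hsub ht), half1 t (hsub ht)]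
  have key3 : ∀ t ∈ Set.Ico a b, gap S₂ S₃ t (e₁ t) = 2 * Real.sin (δ t / 2) *
      (gapConst S₂ S₃ t * Real.sin (δ t / 2) - √(gapDisc S₂ S₃ t) * Real.cos (δ t / 2)) :=
    fun t ht => by simpa using half3 t (hsub ht) 0
  have ne1 : ∀ t ∈ Set.Ico a b, gapConst S₂ S₁ t * Real.sin (δ t / 2) -
      √(gapDisc S₂ S₁ t) * Real.cos (δ t / 2) ≠ 0 := fun t ht h0 =>
    huniq t ht (e₃ t) (n3 t (hsub ht)) (by rw [key1 t ht, h0, mul_zero]) (g3 t (hsub ht))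
  have ne3 : ∀ t ∈ Set.Ico a b, gapConst S₂ S₃ t * Real.sin (δ t / 2) -
      √(gapDisc S₂ S₃ t) * Real.cos (δ t / 2) ≠ 0 := fun t ht h0 =>
    huniq t ht (e₁ t) (n1 t (hsub ht)) (g1 t (hsub ht)) (by rw [key3 t ht, h0, mul_zero])
  have hlim : Tendsto (fun t => Real.cos (δ t)) (𝓝[<] b) (𝓝 1) := by
    have hw : ContinuousOn (fun t => (e₃ t * starRingEnd ℂ (e₁ t)).re) (Set.Icc a b) :=
      Complex.continuous_re.comp_continuousOn
        (hc3.mul (Complex.continuous_conj.comp_continuousOn hc1))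
    have h := (hw b hbb).mono_left (nhdsWithin_le_of_mem
      (mem_of_superset (Ico_mem_nhdsLT hab) hsub))
    beta_reduce at h
    rw [e1b, e3b, mul_conj_of_norm_eq_one hv, Complex.one_re] at h
    refine h.congr' ?_
    filter_upwards [Ico_mem_nhdsLT hab] with t ht
    rw [← exp_turn (n1 t (hsub ht)) (n3 t (hsub ht)), Complex.exp_ofReal_mul_I_re]
  have cA1 : ContinuousOn (gapConst S₂ S₁) (Set.Icc a b) := (continuous_gapConst _ _).continuousOn
  have cA3 : ContinuousOn (gapConst S₂ S₃) (Set.Icc a b) := (continuous_gapConst _ _).continuousOn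
  have cR1 : ContinuousOn (fun t => √(gapDisc S₂ S₁ t)) (Set.Icc a b) :=
    (continuous_gapDisc _ _).sqrt.continuousOn
  have cR3 : ContinuousOn (fun t => √(gapDisc S₂ S₃ t)) (Set.Icc a b) :=
    (continuous_gapDisc _ _).sqrt.continuousOn
  have haa : a ∈ Set.Ico a b := Set.left_mem_Ico.2 hab
  have hsigns : (∀ t ∈ Set.Ico a b, gapConst S₂ S₁ t * Real.sin (δ t / 2) -
        √(gapDisc S₂ S₁ t) * Real.cos (δ t / 2) < 0) ∧
      (∀ t ∈ Set.Ico a b, gapConst S₂ S₃ t * Real.sin (δ t / 2) -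
        √(gapDisc S₂ S₃ t) * Real.cos (δ t / 2) < 0) ∧ Tendsto δ (𝓝[<] b) (𝓝 0) := by
    -- The site on the sweep circle at a has a nonpositive gap in every direction, in particular at
    -- the end belonging to the other pair.
    rcases ha with ha | ha
    · refine arc_signs hab hδcont hδpos hδlt hlim cA1 cR1 cA3 cR3 d1 d3 ne1 ne3 ?_
      have h := gap_nonpos_of_radius_eq h2.le ha (n3 a (hsub haa))
      rw [key1 a haa] at h
      by_contra hcon
      push Not at hcon
      exact absurd h (not_le.2 (mul_pos (mul_pos two_pos (hsinpos a haa)) hcon))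
    · have hh := arc_signs hab hδcont hδpos hδlt hlim cA3 cR3 cA1 cR1 d3 d1 ne3 ne1 ?_
      · exact ⟨hh.2.1, hh.1, hh.2.2⟩
      have h := gap_nonpos_of_radius_eq h2.le ha (n1 a (hsub haa))
      rw [key3 a haa] at h
      by_contra hcon
      push Not at hcon
      exact absurd h (not_le.2 (mul_pos (mul_pos two_pos (hsinpos a haa)) hcon))
  obtain ⟨neg1, neg3, hδ0⟩ := hsigns
  have hδb : δ b = 0 := by simp only [hδ, e1b, e3b, turn_self hv]
  refine ⟨e₁, e₃, δ, ⟨hc1, hc3, ?_, n1, n3, hδpos, hδb, fun _ _ => rfl, g1, g3, ?_, ?_⟩, e1b, e3b⟩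
  · intro t ht
    rcases ht.2.lt_or_eq with hlt | rfl
    · exact (hδcont t ⟨ht.1, hlt⟩).mono_of_mem_nhdsWithin
        (mem_nhdsWithin.2 ⟨Set.Iio b, isOpen_Iio, hlt, fun x hx => ⟨hx.2.1, hx.1⟩⟩)
    -- At b the ends coincide, where `turn` may jump; continuity here is exactly the limit obtained
    -- from `arc_signs`.
    · rw [← Set.Ico_insert_right hab.le, continuousWithinAt_insert_self, ContinuousWithinAt, hδb,
        nhdsWithin_Ico_eq_nhdsLT hab]
      exact hδ0
  · intro t ht x hx hxδ
    have hlt := hδlt t ht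
    rw [half1 t (hsub ht)]
    refine mul_neg_of_pos_of_neg (mul_pos two_pos (Real.sin_pos_of_pos_of_lt_pi (by linarith)
      (by linarith))) ?_
    exact arc_neg_of_le (Real.sqrt_nonneg _) (by linarith) (by linarith) (by linarith) (neg1 t ht)
  · intro t ht x hx hxδ
    have hlt := hδlt t ht
    rw [half3 t (hsub ht)]
    refine mul_neg_of_pos_of_neg (mul_pos two_pos (Real.sin_pos_of_pos_of_lt_pi (by linarith)
      (by linarith))) ?_
    exact arc_neg_of_le (Real.sqrt_nonneg _) (by linarith) (by linarith) (by linarith) (neg3 t ht)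

/-! ### The other sites -/

lemma gap_self (S : Hyp) (t : ℝ) (e : ℂ) : gap S S t e = 0 := by rw [gap_eq]; ring

/-- If three beach ellipses meet in a point that is not inside another one, there is an event. -/
lemma mem_eventRadii_of_gap_eq_zero {𝒮 : Finset Hyp} {S A B : Hyp} {t : ℝ} {e : ℂ} (he : ‖e‖ = 1)
    (hS : S ∈ 𝒮) (hA : A ∈ 𝒮) (hB : B ∈ 𝒮) (hSA : S ≠ A) (hSB : S ≠ B) (hAB : A ≠ B)
    (hSt : radius S < t) (hgA : gap S A t e = 0) (hgB : gap S B t e = 0)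
    (hall : ∀ U ∈ 𝒮, gap S U t e ≤ 0) : t ∈ eventRadii 𝒮 := by
  have hinc : ∀ U ∈ 𝒮, gap S U t e = 0 → U ∈ incidentSites 𝒮 (ellipsePoint t S e) ∧
      hdist (ellipsePoint t S e) U = t - ellipseRadius t S e := fun U hU hg => by
    have h := mem_beachEllipse_of_gap_eq_zero he hSt hg
    rw [beachEllipse, Set.mem_ofPred_eq, radius_ellipsePoint he hSt] at h
    refine ⟨⟨hU, fun T hT => ?_⟩, h⟩
    rw [h]
    exact le_hdist_of_gap_nonpos he hSt (hall T hT)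
  have hS' := hinc S hS (gap_self S t e)
  have h := radius_add_hdist_mem_eventRadii hSA hSB hAB hS'.1 (hinc A hA hgA).1 (hinc B hB hgB).1
  rwa [hS'.2, radius_ellipsePoint he hSt, add_sub_cancel] at h

lemma slope_eq_zero_of_isLocalMax {S T : Hyp} {t : ℝ} {e : ℂ} (h : gap S T t e = 0)
    (hmax : ∀ᶠ z : ℝ in 𝓝 0, gap S T t (e * Complex.exp ((z : ℂ) * Complex.I)) ≤ 0) :
    dot (gapVec S T t) (Complex.I * e) = 0 := by
  set σ := dot (gapVec S T t) (Complex.I * e)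
  have hd : HasDerivAt (fun z => gapConst S T t * (1 - Real.cos z) + σ * Real.sin z) σ 0 := by
    have h1 := ((Real.hasDerivAt_cos 0).const_sub 1).const_mul (gapConst S T t)
    have h2 := (Real.hasDerivAt_sin 0).const_mul σ
    simpa using h1.fun_add h2
  refine IsLocalMax.hasDerivAt_eq_zero ?_ hd
  filter_upwards [hmax] with z hz
  rw [gap_rotate h] at hz
  simpa using hz

/-- On an arc where the ellipse of `T` is not outside the one of `S`, the two can touch only if `T`
is on the sweep circle. -/
lemma radius_eq_of_touch {S T : Hyp} {t : ℝ} {e : ℂ} {x l : ℝ} (he : ‖e‖ = 1) (hST : S ≠ T)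
    (hS : radius S < t) (hx : 0 < x) (hxl : x < l)
    (hle : ∀ y : ℝ, 0 ≤ y → y ≤ l → gap S T t (e * Complex.exp ((y : ℂ) * Complex.I)) ≤ 0)
    (h0 : gap S T t (e * Complex.exp ((x : ℂ) * Complex.I)) = 0) : radius T = t := by
  have hn : ‖e * Complex.exp ((x : ℂ) * Complex.I)‖ = 1 := by
    rw [norm_mul, he, Complex.norm_exp_ofReal_mul_I, mul_one]
  -- An interior zero of a nonpositive function is a local maximum. The slope vanishes there, and
  -- its square is the discriminant.
  refine radius_eq_of_gapDisc_eq_zero hST hS ?_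
  rw [← slope_sq hn h0, slope_eq_zero_of_isLocalMax h0, zero_pow two_ne_zero]
  have h1 : ∀ᶠ z : ℝ in 𝓝 0, -x < z := lt_mem_nhds (by linarith)
  have h2 : ∀ᶠ z : ℝ in 𝓝 0, z < l - x := gt_mem_nhds (by linarith)
  filter_upwards [h1, h2] with z hz1 hz2
  have := hle (x + z) (by linarith) (by linarith)
  rwa [Complex.ofReal_add, add_mul, Complex.exp_add, ← mul_assoc] at this

section others

variable {𝒮 : Finset Hyp} {S₁ S₂ S₃ : Hyp} {r b : ℝ} {e₁ e₃ : ℝ → ℂ} {δ : ℝ → ℝ}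

/-- Measuring position as a fraction of the arc makes the domain a fixed compact box, including b,
where the arc is a single point. -/
lemma MovingArc.continuousOn_gap (M : MovingArc S₁ S₂ S₃ r b e₁ e₃ δ) (T : Hyp) :
    ContinuousOn (fun p : ℝ × ℝ => gap S₂ T p.2
      (e₁ p.2 * Complex.exp (((p.1 * δ p.2 : ℝ) : ℂ) * Complex.I)))
      (Set.Icc 0 1 ×ˢ Set.Icc r b) := by
  have hsnd : Set.MapsTo Prod.snd (Set.Icc (0 : ℝ) 1 ×ˢ Set.Icc r b) (Set.Icc r b) :=
    fun p hp => hp.2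
  have h1 : ContinuousOn (fun p : ℝ × ℝ => e₁ p.2) (Set.Icc 0 1 ×ˢ Set.Icc r b) :=
    M.continuousOn_fst.comp _root_.continuousOn_snd hsnd
  have h2 : ContinuousOn (fun p : ℝ × ℝ => δ p.2) (Set.Icc 0 1 ×ˢ Set.Icc r b) :=
    M.continuousOn_length.comp _root_.continuousOn_snd hsnd
  have h3 : ContinuousOn (fun p : ℝ × ℝ => ((p.1 * δ p.2 : ℝ) : ℂ))
      (Set.Icc 0 1 ×ˢ Set.Icc r b) :=
    Complex.continuous_ofReal.comp_continuousOn (_root_.continuousOn_fst.mul h2)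
  have h4 : ContinuousOn (fun p : ℝ × ℝ => e₁ p.2 *
      Complex.exp (((p.1 * δ p.2 : ℝ) : ℂ) * Complex.I)) (Set.Icc 0 1 ×ˢ Set.Icc r b) :=
    h1.mul (h3.mul continuousOn_const).cexp
  exact Continuous.comp_continuousOn (g := fun p : ℝ × ℂ => gap S₂ T p.1 p.2)
    (f := fun p : ℝ × ℝ => (p.2, e₁ p.2 * Complex.exp (((p.1 * δ p.2 : ℝ) : ℂ) * Complex.I)))
    (continuous_gap S₂ T) (_root_.continuousOn_snd.prodMk h4)

/-- Passing to the limit from later sweep radii. -/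
lemma MovingArc.gap_nonpos_of_later (M : MovingArc S₁ S₂ S₃ r b e₁ e₃ δ) {T : Hyp} {t : ℝ}
    (ht : t ∈ Set.Ico r b)
    (h : ∀ u ∈ Set.Ioo t b, ∀ x, 0 ≤ x → x ≤ δ u →
      gap S₂ T u (e₁ u * Complex.exp ((x : ℂ) * Complex.I)) < 0) (x : ℝ) (hx : 0 ≤ x)
    (hxδ : x ≤ δ t) : gap S₂ T t (e₁ t * Complex.exp ((x : ℂ) * Complex.I)) ≤ 0 := by
  have hδ := M.length_pos t ht
  -- The fraction of the arc is kept fixed while the sweep radius decreases to t.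
  have hy : x / δ t ∈ Set.Icc (0 : ℝ) 1 := ⟨by positivity, (div_le_one hδ).2 hxδ⟩
  have hc : ContinuousOn (fun u => gap S₂ T u
      (e₁ u * Complex.exp (((x / δ t * δ u : ℝ) : ℂ) * Complex.I))) (Set.Icc r b) :=
    (M.continuousOn_gap T).comp (f := fun u : ℝ => (x / δ t, u))
      (continuousOn_const.prodMk continuousOn_id) fun u hu => ⟨hy, hu⟩
  have hlim := (hc t ⟨ht.1, ht.2.le⟩).mono_left (nhdsWithin_mono t
    (fun u (hu : u ∈ Set.Ioo t b) => ⟨ht.1.trans hu.1.le, hu.2.le⟩))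
  rw [nhdsWithin_Ioo_eq_nhdsGT ht.2] at hlim
  beta_reduce at hlim
  rw [div_mul_cancel₀ _ hδ.ne'] at hlim
  refine le_of_tendsto hlim ?_
  filter_upwards [Ioo_mem_nhdsGT ht.2] with u hu
  have hδu := M.length_pos u ⟨ht.1.trans hu.1.le, hu.2⟩
  exact (h u hu _ (mul_nonneg hy.1 hδu.le) (mul_le_of_le_one_left hδu.le hy.2)).le

/-- Going back from b, the latest contact of a further ellipse with the arc would be an event
strictly between r and b. -/
theorem MovingArc.gap_neg_of_lt (M : MovingArc S₁ S₂ S₃ r b e₁ e₃ δ)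
    (hS₁ : S₁ ∈ 𝒮) (hS₂ : S₂ ∈ 𝒮) (hS₃ : S₃ ∈ 𝒮) (h21 : S₂ ≠ S₁) (h23 : S₂ ≠ S₃)
    (h2 : radius S₂ < r)
    (hend : ∀ T ∈ 𝒮, T ≠ S₁ → T ≠ S₂ → T ≠ S₃ → gap S₂ T b (e₁ b) < 0)
    (hev : ∀ q ∈ eventRadii 𝒮, q < b → q ≤ r) :
    ∀ t ∈ Set.Ioo r b, ∀ T ∈ 𝒮, T ≠ S₁ → T ≠ S₂ → T ≠ S₃ → ∀ x, 0 ≤ x → x ≤ δ t →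
      gap S₂ T t (e₁ t * Complex.exp ((x : ℂ) * Complex.I)) < 0 := by
  intro t₀ ht₀ T₀ hT₀ hT1 hT2 hT3 x₀ hx₀ hxδ₀
  by_contra hcon
  push Not at hcon
  let F : Hyp → ℝ × ℝ → ℝ := fun T p => gap S₂ T p.2
    (e₁ p.2 * Complex.exp (((p.1 * δ p.2 : ℝ) : ℂ) * Complex.I))
  let O : Set Hyp := {T | T ∈ 𝒮 ∧ T ≠ S₁ ∧ T ≠ S₂ ∧ T ≠ S₃}
  let K : Set (ℝ × ℝ) := ⋃ T ∈ O, (Set.Icc 0 1 ×ˢ Set.Icc t₀ b) ∩ F T ⁻¹' Set.Ici 0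
  have hO : O.Finite := 𝒮.finite_toSet.subset fun T hT => hT.1
  have hbox : IsCompact (Set.Icc (0 : ℝ) 1 ×ˢ Set.Icc t₀ b) := isCompact_Icc.prod isCompact_Icc
  have hK : IsCompact K := hO.isCompact_biUnion fun T _ => by
    refine hbox.of_isClosed_subset ?_ Set.inter_subset_left
    refine ((M.continuousOn_gap T).mono ?_).preimage_isClosed_of_isClosed hbox.isClosed isClosed_Ici
    exact Set.prod_mono le_rfl (Set.Icc_subset_Icc_left ht₀.1.le)
  have hδ₀ := M.length_pos t₀ ⟨ht₀.1.le, ht₀.2⟩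
  have hKne : K.Nonempty := by
    refine ⟨(x₀ / δ t₀, t₀), Set.mem_biUnion (show T₀ ∈ O from ⟨hT₀, hT1, hT2, hT3⟩)
      ⟨⟨⟨by positivity, (div_le_one hδ₀).2 hxδ₀⟩, Set.left_mem_Icc.2 ht₀.2.le⟩, ?_⟩⟩
    simp only [F, Set.mem_preimage, Set.mem_Ici]
    rwa [div_mul_cancel₀ _ hδ₀.ne']
  -- Compactness gives a latest contact; it is before b, where the arc is the single direction
  -- covered by `hend`.
  obtain ⟨⟨y, t⟩, hp, hmax⟩ := hK.exists_isMaxOn hKne continuous_snd.continuousOn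
  simp only [K, Set.mem_iUnion] at hp
  obtain ⟨T, hT, ⟨hy, ht⟩, hF⟩ := hp
  simp only [F, Set.mem_preimage, Set.mem_Ici] at hF
  have htb : t < b := by
    refine lt_of_le_of_ne ht.2 ?_
    rintro rfl
    rw [M.length_end, mul_zero, Complex.ofReal_zero, zero_mul, Complex.exp_zero, mul_one] at hF
    exact absurd hF (not_le.2 (hend T hT.1 hT.2.1 hT.2.2.1 hT.2.2.2))
  have hrt : r < t := ht₀.1.trans_le ht.1
  have htIco : t ∈ Set.Ico r b := ⟨hrt.le, htb⟩
  have hδ := M.length_pos t htIco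
  have hlater : ∀ U ∈ O, ∀ u ∈ Set.Ioo t b, ∀ x, 0 ≤ x → x ≤ δ u →
      gap S₂ U u (e₁ u * Complex.exp ((x : ℂ) * Complex.I)) < 0 := fun U hU u hu x hx hxu => by
    by_contra hcon
    push Not at hcon
    have hδu := M.length_pos u ⟨hrt.le.trans hu.1.le, hu.2⟩
    have hmem : (x / δ u, u) ∈ K := by
      refine Set.mem_biUnion hU ⟨⟨⟨by positivity, (div_le_one hδu).2 hxu⟩,
        ht.1.trans hu.1.le, hu.2.le⟩, ?_⟩
      simp only [F, Set.mem_preimage, Set.mem_Ici]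
      rwa [div_mul_cancel₀ _ hδu.ne']
    exact absurd (hmax hmem) (not_le.2 hu.1)
  have hnonpos : ∀ U ∈ O, ∀ x : ℝ, 0 ≤ x → x ≤ δ t →
      gap S₂ U t (e₁ t * Complex.exp ((x : ℂ) * Complex.I)) ≤ 0 := fun U hU x hx hxt =>
    M.gap_nonpos_of_later htIco (hlater U hU) x hx hxt
  have hx0 : 0 ≤ y * δ t := mul_nonneg hy.1 hδ.le
  have hxl : y * δ t ≤ δ t := mul_le_of_le_one_left hδ.le hy.2
  have hzero := le_antisymm (hnonpos T hT _ hx0 hxl) hF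
  have hn1 := M.norm_fst t ⟨hrt.le, htb.le⟩
  have hnx : ∀ x : ℝ, ‖e₁ t * Complex.exp ((x : ℂ) * Complex.I)‖ = 1 := fun x => by
    rw [norm_mul, hn1, Complex.norm_exp_ofReal_mul_I, mul_one]
  have hg1 := M.gap_fst t ⟨hrt.le, htb.le⟩
  have hg3 := M.gap_snd t ⟨hrt.le, htb.le⟩
  rw [← mul_exp_turn hn1 (M.norm_snd t ⟨hrt.le, htb.le⟩),
    ← M.length_eq t ⟨hrt.le, htb.le⟩] at hg3
  have hall : ∀ x : ℝ, 0 ≤ x → x ≤ δ t → ∀ U ∈ 𝒮,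
      gap S₂ U t (e₁ t * Complex.exp ((x : ℂ) * Complex.I)) ≤ 0 := fun x hx hxt U hU => by
    by_cases hU1 : U = S₁
    · rw [hU1]
      rcases hx.eq_or_lt with rfl | hx
      · simpa using hg1.le
      · exact (M.neg_fst t htIco x hx hxt).le
    by_cases hU3 : U = S₃
    · rw [hU3]
      rcases hxt.eq_or_lt with rfl | hxt
      · exact hg3.le
      · exact (M.neg_snd t htIco x hx hxt).le
    by_cases hU2 : U = S₂
    · rw [hU2, gap_self]
    exact hnonpos U ⟨hU, hU1, hU2, hU3⟩ x hx hxt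
  have hevent : t ∈ eventRadii 𝒮 := by
    -- Contact at either end gives three nearest sites, hence a Voronoi vertex; contact in between
    -- is a tangency, hence a site on the sweep circle.
    rcases hx0.eq_or_lt with h0 | h0
    · rw [← h0] at hzero
      exact mem_eventRadii_of_gap_eq_zero (hnx 0) hS₂ hS₁ hT.1 h21 hT.2.2.1.symm hT.2.1.symm
        (h2.trans hrt) (by simpa using hg1) hzero (hall 0 le_rfl hδ.le)
    rcases hxl.eq_or_lt with hl | hl
    · rw [hl] at hzero
      exact mem_eventRadii_of_gap_eq_zero (hnx (δ t)) hS₂ hS₃ hT.1 h23 hT.2.2.1.symm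
        hT.2.2.2.symm (h2.trans hrt) hg3 hzero (hall (δ t) hδ.le le_rfl)
    · rw [← radius_eq_of_touch hn1 hT.2.2.1.symm (h2.trans hrt) h0 hl (hnonpos T hT) hzero]
      exact radius_mem_eventRadii hT.1
  exact absurd (hev t hevent htb) (not_le.2 hrt)

theorem MovingArc.gap_nonpos (M : MovingArc S₁ S₂ S₃ r b e₁ e₃ δ)
    (hS₁ : S₁ ∈ 𝒮) (hS₂ : S₂ ∈ 𝒮) (hS₃ : S₃ ∈ 𝒮) (h21 : S₂ ≠ S₁) (h23 : S₂ ≠ S₃)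
    (h2 : radius S₂ < r)
    (hend : ∀ T ∈ 𝒮, T ≠ S₁ → T ≠ S₂ → T ≠ S₃ → gap S₂ T b (e₁ b) < 0)
    (hev : ∀ q ∈ eventRadii 𝒮, q < b → q ≤ r) {t : ℝ} (ht : t ∈ Set.Ico r b) {T : Hyp}
    (hT : T ∈ 𝒮) {x : ℝ} (hx : 0 ≤ x) (hxδ : x ≤ δ t) :
    gap S₂ T t (e₁ t * Complex.exp ((x : ℂ) * Complex.I)) ≤ 0 := by
  have ht' : t ∈ Set.Icc r b := ⟨ht.1, ht.2.le⟩
  by_cases hU1 : T = S₁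
  · rw [hU1]
    rcases hx.eq_or_lt with rfl | hx
    · simpa using (M.gap_fst t ht').le
    · exact (M.neg_fst t ht x hx hxδ).le
  by_cases hU3 : T = S₃
  · rw [hU3]
    rcases hxδ.eq_or_lt with rfl | hxt
    · rw [M.length_eq t ht', mul_exp_turn (M.norm_fst t ht') (M.norm_snd t ht')]
      exact (M.gap_snd t ht').le
    · exact (M.neg_snd t ht x hx hxt).le
  by_cases hU2 : T = S₂
  · rw [hU2, gap_self]
  exact M.gap_nonpos_of_later ht (fun u hu => M.gap_neg_of_lt hS₁ hS₂ hS₃ h21 h23 h2 hend hev u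
    ⟨ht.1.trans_lt hu.1, hu.2⟩ T hT hU1 hU2 hU3) x hx hxδ

/-- Only t = r is new, since r may itself be an event. A zero inside the arc would be a site just
reached, and shortly afterwards its direction would still lie on the arc with a positive gap. -/
theorem MovingArc.gap_neg (M : MovingArc S₁ S₂ S₃ r b e₁ e₃ δ)
    (hS₁ : S₁ ∈ 𝒮) (hS₂ : S₂ ∈ 𝒮) (hS₃ : S₃ ∈ 𝒮) (h21 : S₂ ≠ S₁) (h23 : S₂ ≠ S₃)
    (h2 : radius S₂ < r)
    (hend : ∀ T ∈ 𝒮, T ≠ S₁ → T ≠ S₂ → T ≠ S₃ → gap S₂ T b (e₁ b) < 0)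
    (hev : ∀ q ∈ eventRadii 𝒮, q < b → q ≤ r) {t : ℝ} (ht : t ∈ Set.Ico r b) {T : Hyp}
    (hT : T ∈ 𝒮) (hTS : T ≠ S₂) {x : ℝ} (hx : 0 < x) (hxδ : x < δ t) :
    gap S₂ T t (e₁ t * Complex.exp ((x : ℂ) * Complex.I)) < 0 := by
  by_cases hU1 : T = S₁
  · rw [hU1]; exact M.neg_fst t ht x hx hxδ.le
  by_cases hU3 : T = S₃
  · rw [hU3]; exact M.neg_snd t ht x hx.le hxδ
  have hlater := M.gap_neg_of_lt hS₁ hS₂ hS₃ h21 h23 h2 hend hev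
  rcases ht.1.lt_or_eq with hrt | rfl
  · exact hlater t ⟨hrt, ht.2⟩ T hT hU1 hTS hU3 x hx.le hxδ.le
  refine lt_of_le_of_ne (M.gap_nonpos hS₁ hS₂ hS₃ h21 h23 h2 hend hev ht hT hx.le hxδ.le)
    fun h0 => ?_
  have hrr : r ∈ Set.Icc r b := ⟨le_rfl, ht.2.le⟩
  have hn1 := M.norm_fst r hrr
  have hrad : radius T = r := radius_eq_of_touch hn1 hTS.symm h2 hx hxδ
    (fun y hy hyl => M.gap_nonpos hS₁ hS₂ hS₃ h21 h23 h2 hend hev ht hT hy hyl) h0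
  have hdir : unitDir T = e₁ r * Complex.exp ((x : ℂ) * Complex.I) :=
    eq_unitDir_of_gap_eq_zero h2 hrad
      (by rw [norm_mul, hn1, Complex.norm_exp_ofReal_mul_I, mul_one]) h0
  have hxpi : x < 2 * Real.pi := by
    have := turn_lt (e₁ r) (e₃ r)
    rw [← M.length_eq r hrr] at this
    linarith
  have hturn : turn (e₁ r) (unitDir T) = x := by
    refine eq_of_exp_eq (turn_nonneg _ _) (turn_lt _ _) hx.le hxpi ?_
    rw [exp_turn hn1 (norm_unitDir T), hdir]
    linear_combination Complex.exp ((x : ℂ) * Complex.I) * mul_conj_of_norm_eq_one hn1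
  have hne : e₁ r ≠ unitDir T := fun h => by
    rw [← h, turn_self hn1] at hturn
    exact hx.ne hturn
  have hc : ContinuousWithinAt (fun t => turn (e₁ t) (unitDir T)) (Set.Icc r b) r :=
    continuousWithinAt_turn M.norm_fst (fun _ _ => norm_unitDir T) (M.continuousOn_fst r hrr)
      continuousWithinAt_const hrr hne
  have hle : 𝓝[>] r ≤ 𝓝[Set.Icc r b] r := by
    rw [← nhdsWithin_Ioo_eq_nhdsGT ht.2]
    exact nhdsWithin_mono r Set.Ioo_subset_Icc_self
  have l1 : Tendsto (fun t => turn (e₁ t) (unitDir T)) (𝓝[>] r) (𝓝 x) := by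
    have := hc.mono_left hle
    beta_reduce at this
    rwa [hturn] at this
  have l2 : Tendsto δ (𝓝[>] r) (𝓝 (δ r)) := (M.continuousOn_length r hrr).mono_left hle
  -- Just after r, the direction of T is still before the end of the moving arc.
  have hev1 := l1.eventually_lt l2 hxδ
  obtain ⟨u, hu1, hu⟩ := (hev1.and (Ioo_mem_nhdsGT ht.2)).exists
  have h := hlater u hu T hT hU1 hTS hU3 _ (turn_nonneg (e₁ u) (unitDir T)) hu1.le
  rw [mul_exp_turn (M.norm_fst u ⟨hu.1.le, hu.2.le⟩) (norm_unitDir T)] at h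
  exact absurd h (not_lt.2 (gap_unitDir_pos (by rw [hrad]; exact h2) (by rw [hrad]; exact hu.1)).le)

end others

/-! ### The incident sites in order, and the assembly of the theorem -/

lemma exists_sorted_triple {α : Type*} (f : α → ℝ) {s : Set α} {x y z : α}
    (hs : s = {x, y, z}) (hxy : f x ≠ f y) (hxz : f x ≠ f z) (hyz : f y ≠ f z) :
    ∃ a b c, s = {a, b, c} ∧ f a < f b ∧ f b < f c := by
  rcases lt_or_gt_of_ne hxy with h1 | h1 <;> rcases lt_or_gt_of_ne hxz with h2 | h2 <;>
    rcases lt_or_gt_of_ne hyz with h3 | h3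
  · exact ⟨x, y, z, hs, h1, h3⟩
  · exact ⟨x, z, y, hs.trans (by ext; simp; tauto), h2, h3⟩
  · linarith
  · exact ⟨z, x, y, hs.trans (by ext; simp; tauto), h2, h1⟩
  · exact ⟨y, x, z, hs.trans (by ext; simp; tauto), h1, h2⟩
  · linarith
  · exact ⟨y, z, x, hs.trans (by ext; simp; tauto), h3, h2⟩
  · exact ⟨z, y, x, hs.trans (by ext; simp; tauto), h3, h1⟩

/-- The witness circle of a Voronoi vertex off the pole, and the cyclic order of three sites on
it. -/
lemma exists_incidenceTuple {𝒮 : Finset Hyp} {V V' : Hyp} (hV : IsVoronoiVertex 𝒮 V)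
    (hV' : IsFarPoint 𝒮 V V') (hthree : (incidentSites 𝒮 V).ncard ≤ 3) (hpole : V ≠ 0)
    (hfar : V' ∉ 𝒮) : ∃ (S₁ S₂ S₃ : Hyp) (R : ℝ), IsIncidenceTuple 𝒮 V V' S₁ S₂ S₃ ∧ 0 < R ∧
      V' = ((radius V + R : ℝ) : ℂ) * unitDir V ∧ (∀ S ∈ incidentSites 𝒮 V, hdist V S = R) ∧
      0 < cwAngle V' V S₁ := by
  obtain ⟨x, y, z, hxy, hxz, hyz, hs⟩ := Set.ncard_eq_three.1 (le_antisymm hthree hV)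
  have hx : x ∈ incidentSites 𝒮 V := by rw [hs]; simp
  have hy : y ∈ incidentSites 𝒮 V := by rw [hs]; simp
  have hz : z ∈ incidentSites 𝒮 V := by rw [hs]; simp
  have hall : ∀ S ∈ incidentSites 𝒮 V, hdist V S = hdist V x := fun S hS =>
    hdist_eq_of_mem_incidentSites hS hx
  have hR : 0 < hdist V x := by
    -- The vertex may itself be a site, but another incident site at the same distance still shows
    -- that the distance is positive.
    by_cases h : V = x
    · rw [← hall y hy]
      exact hdist_pos (by rw [h]; exact hxy)
    · exact hdist_pos h
  have hrad := hV'.eq_radial hx hpole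
  have hinj : ∀ S ∈ incidentSites 𝒮 V, ∀ T ∈ incidentSites 𝒮 V, S ≠ T →
      cwAngle V' V S ≠ cwAngle V' V T := fun S hS T hT hne h =>
    hne (eq_of_cwAngle_eq hR hrad (hall S hS) (hall T hT) h)
  obtain ⟨S₁, S₂, S₃, h123, h12, h23⟩ := exists_sorted_triple (cwAngle V' V) hs
    (hinj x hx y hy hxy) (hinj x hx z hz hxz) (hinj y hy z hz hyz)
  have h1 : S₁ ∈ incidentSites 𝒮 V := by rw [h123]; simp
  refine ⟨S₁, S₂, S₃, hdist V x, ⟨h123, h12, h23⟩, hR, hrad, hall, ?_⟩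
  exact cwAngle_pos hR hrad (hall S₁ h1) fun h => hfar (h ▸ h1.1)

end HypSweep

open HypSweep in
theorem mainTheorem2 (𝒮 : Finset Hyp) (V V' : Hyp)
    (hV : IsVoronoiVertex 𝒮 V) (hV' : IsFarPoint 𝒮 V V')
    (hthree : (incidentSites 𝒮 V).ncard ≤ 3)
    (hpole : V ≠ 0) (hfar : V' ∉ 𝒮) :
    ∃ S₁ S₂ S₃ : Hyp, IsIncidenceTuple 𝒮 V V' S₁ S₂ S₃ ∧
    ∃ r : ℝ, IsGreatest {q | q ∈ eventRadii 𝒮 ∧ q < radius V'} r ∧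
    ∃ I₁₂ I₂₃ : ℝ → Hyp,
      ContinuousOn I₁₂ (Set.Icc r (radius V')) ∧ ContinuousOn I₂₃ (Set.Icc r (radius V')) ∧
      I₁₂ (radius V') = V ∧ I₂₃ (radius V') = V ∧
      ∀ t ∈ Set.Icc r (radius V'),
        I₁₂ t ∈ beachEllipse t S₁ ∩ beachEllipse t S₂ ∧
        I₂₃ t ∈ beachEllipse t S₂ ∩ beachEllipse t S₃ ∧
        (t < radius V' →
          Consecutive 𝒮 t (I₁₂ t) (I₂₃ t) ∧
          ∀ X ∈ beachCurve 𝒮 t, StrictlyBetween (I₁₂ t) X (I₂₃ t) → X ∈ activePart 𝒮 t S₂) := by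
  obtain ⟨S₁, S₂, S₃, R, htuple, hR, hrad, hall, h0⟩ :=
    exists_incidenceTuple hV hV' hthree hpole hfar
  obtain ⟨hinc, h12, h23⟩ := id htuple
  have i1 : S₁ ∈ incidentSites 𝒮 V := by rw [hinc]; simp
  have i2 : S₂ ∈ incidentSites 𝒮 V := by rw [hinc]; simp
  have i3 : S₃ ∈ incidentSites 𝒮 V := by rw [hinc]; simp
  have d1 := hall S₁ i1
  have d2 := hall S₂ i2
  have d3 := hall S₃ i3
  have hv : 0 < radius V := norm_pos_iff.2 hpole
  have hb : radius V' = radius V + R := by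
    rw [hrad]; exact radius_mul_of_norm_eq_one (by linarith) (norm_unitDir V)
  have hb0 : 0 ≤ radius V + R := by linarith
  have n21 : S₂ ≠ S₁ := by rintro rfl; exact lt_irrefl _ h12
  have n23 : S₂ ≠ S₃ := by rintro rfl; exact lt_irrefl _ h23
  have n13 : S₁ ≠ S₃ := by rintro rfl; exact lt_irrefl _ (h12.trans h23)
  have hlt : ∀ S, hdist V S = R → 0 < cwAngle V' V S → radius S < radius V + R := by
    intro S hS hpos
    refine radius_lt_of_timeCoord_lt hb0 (sub_pos.1 ?_)
    rw [cosh_sub_timeCoord hR hrad hS]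
    have h1 : 0 < Real.sinh (radius V) := Real.sinh_pos_iff.2 hv
    have h2 : 0 < Real.sinh R := Real.sinh_pos_iff.2 hR
    have h3 := sin_half_cwAngle_pos hpos
    positivity
  have l1 := hlt S₁ d1 h0
  have l2 := hlt S₂ d2 (h0.trans h12)
  have l3 := hlt S₃ d3 (h0.trans (h12.trans h23))
  have hVmem : ∀ S, hdist V S = R → V ∈ beachEllipse (radius V + R) S := fun S hS => by
    rw [beachEllipse, Set.mem_ofPred_eq, hS]; ring
  have hVpt := eq_ellipsePoint_of_mem (hVmem S₂ d2) l2
  have hnV := norm_unitDir V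
  have g1 : gap S₂ S₁ (radius V + R) (unitDir V) = 0 :=
    gap_eq_zero_of_mem hnV l2 (by rw [← hVpt]; exact hVmem S₁ d1)
  have g3 : gap S₂ S₃ (radius V + R) (unitDir V) = 0 :=
    gap_eq_zero_of_mem hnV l2 (by rw [← hVpt]; exact hVmem S₃ d3)
  have s1 : dot (gapVec S₂ S₁ (radius V + R)) (Complex.I * unitDir V) < 0 := by
    have := slope_pos hR hpole hrad d1 d2 h0 h12
    rw [dot_gapVec]; linarith
  have s3 : 0 < dot (gapVec S₂ S₃ (radius V + R)) (Complex.I * unitDir V) := by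
    have := slope_pos hR hpole hrad d2 d3 (h0.trans h12) h23
    rw [dot_gapVec]; linarith
  -- Hence S₂ is strictly inside the sweep circle for all sweep radii considered, and its ellipse is
  -- never degenerate.
  have ha2 : radius S₂ < max (radius S₁) (radius S₃) := by
    rcases timeCoord_lt_max hR hpole hrad d1 d2 d3 h0 h12 h23 with h | h
    · exact lt_max_of_lt_left (radius_lt_of_timeCoord_lt (radius_nonneg _) h)
    · exact lt_max_of_lt_right (radius_lt_of_timeCoord_lt (radius_nonneg _) h)
  have huniq : ∀ t ∈ Set.Ico (max (radius S₁) (radius S₃)) (radius V + R), ∀ e : ℂ, ‖e‖ = 1 →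
      gap S₂ S₁ t e = 0 → gap S₂ S₃ t e ≠ 0 := fun t ht e he hg1 hg3 => by
    have hSt := ha2.trans_le ht.1
    have m1 := mem_beachEllipse_of_gap_eq_zero he hSt hg1
    have m2 := ellipsePoint_mem he hSt
    have m3 := mem_beachEllipse_of_gap_eq_zero he hSt hg3
    rw [beachEllipse, Set.mem_ofPred_eq] at m1 m2 m3
    -- A triple meeting is equidistant from the three sites, hence V. Its distance R to S₂ must then
    -- equal t - |OV|, which contradicts t < |OV| + R.
    have hP : ellipsePoint t S₂ e = V := eq_of_equidistant n21.symm n23 n13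
      (m1.trans m2.symm) (m3.trans m2.symm) (d1.trans d2.symm) (d3.trans d2.symm)
    rw [hP, d2] at m2
    linarith [ht.2]
  obtain ⟨e₁, e₃, δ, M', he₁, he₃⟩ := exists_movingArc n21 n23 (max_lt l1 l3) (le_max_left _ _) ha2
    (le_max_right _ _) ((max_choice (radius S₁) (radius S₃)).imp Eq.symm Eq.symm) hnV g1 g3 s1 s3
    huniq
  obtain ⟨r, hr⟩ := exists_isGreatest_eventRadii 𝒮 (T := radius V') (by rw [hb]; linarith)
  refine ⟨S₁, S₂, S₃, htuple, r, hr, ?_⟩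
  rw [hb] at hr ⊢
  have hrS : ∀ S, S ∈ 𝒮 → radius S < radius V + R → radius S ≤ r := fun S hS hlt =>
    hr.2 ⟨radius_mem_eventRadii hS, hlt⟩
  have r1 := hrS S₁ i1.1 l1
  have r3 := hrS S₃ i3.1 l3
  have r2 : radius S₂ < r := ha2.trans_le (max_le r1 r3)
  -- The arc was built from the larger of the radii of S₁ and S₃, where its sign can be read; both
  -- radii are events before r(V'), so r is not earlier.
  have M := M'.mono (max_le r1 r3)
  have hend : ∀ T ∈ 𝒮, T ≠ S₁ → T ≠ S₂ → T ≠ S₃ →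
      gap S₂ T (radius V + R) (e₁ (radius V + R)) < 0 := by
    intro T hT hT1 hT2 hT3
    rw [he₁]
    refine gap_neg_of_lt_hdist hnV l2 ?_
    rw [← radius_ellipsePoint hnV l2, ← hVpt, add_sub_cancel_left]
    -- A site at distance at most R from V would be incident, hence one of the three.
    by_contra hle
    push Not at hle
    have hTi : T ∈ incidentSites 𝒮 V := ⟨hT, fun U hU => by
      rw [← d1] at hle
      exact hle.trans (i1.2 U hU)⟩
    rw [hinc] at hTi
    rcases hTi with h | h | h
    exacts [hT1 h, hT2 h, hT3 h]
  have hev : ∀ q ∈ eventRadii 𝒮, q < radius V + R → q ≤ r := fun q hq hlt => hr.2 ⟨hq, hlt⟩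
  refine ⟨fun t => ellipsePoint t S₂ (e₁ t), fun t => ellipsePoint t S₂ (e₃ t),
    continuousOn_ellipsePoint M.continuousOn_fst M.norm_fst fun t ht => r2.trans_le ht.1,
    continuousOn_ellipsePoint M.continuousOn_snd M.norm_snd fun t ht => r2.trans_le ht.1,
    by simp only [he₁, ← hVpt], by simp only [he₃, ← hVpt], fun t ht => ?_⟩
  have hSt := r2.trans_le ht.1
  have hn1 := M.norm_fst t ht
  have hn3 := M.norm_snd t ht
  have m12 : ellipsePoint t S₂ (e₁ t) ∈ beachEllipse t S₁ ∩ beachEllipse t S₂ :=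
    ⟨mem_beachEllipse_of_gap_eq_zero hn1 hSt (M.gap_fst t ht), ellipsePoint_mem hn1 hSt⟩
  have m23 : ellipsePoint t S₂ (e₃ t) ∈ beachEllipse t S₂ ∩ beachEllipse t S₃ :=
    ⟨ellipsePoint_mem hn3 hSt, mem_beachEllipse_of_gap_eq_zero hn3 hSt (M.gap_snd t ht)⟩
  refine ⟨m12, m23, fun htb => ?_⟩
  have ht' : t ∈ Set.Ico r (radius V + R) := ⟨ht.1, htb⟩
  have hδ := M.length_pos t ht'
  have hle : ∀ T ∈ 𝒮, ∀ x : ℝ, 0 ≤ x → x ≤ δ t →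
      gap S₂ T t (e₁ t * Complex.exp ((x : ℂ) * Complex.I)) ≤ 0 := fun T hT x hx hxδ =>
    M.gap_nonpos i1.1 i2.1 i3.1 n21 n23 r2 hend hev ht' hT hx hxδ
  have c12 : ellipsePoint t S₂ (e₁ t) ∈ beachCurve 𝒮 t :=
    ellipsePoint_mem_beachCurve i2.1 hn1 hSt fun T hT _ _ => by
      simpa using hle T hT 0 le_rfl hδ.le
  have c23 : ellipsePoint t S₂ (e₃ t) ∈ beachCurve 𝒮 t :=
    ellipsePoint_mem_beachCurve i2.1 hn3 hSt fun T hT _ _ => by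
      have := hle T hT (δ t) hδ.le le_rfl
      rwa [M.length_eq t ht, mul_exp_turn hn1 hn3] at this
  have hneg : ∀ X, StrictlyBetween (ellipsePoint t S₂ (e₁ t)) X (ellipsePoint t S₂ (e₃ t)) →
      ∀ T ∈ 𝒮, radius T ≤ t → T ≠ S₂ → gap S₂ T t (unitDir X) < 0 := by
    rintro X ⟨hX0, hXδ⟩ T hT - hTS
    rw [ccw_eq_turn, unitDir_ellipsePoint hn1 hSt] at hX0
    rw [ccw_eq_turn, ccw_eq_turn, unitDir_ellipsePoint hn1 hSt, unitDir_ellipsePoint hn3 hSt,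
      ← M.length_eq t ht] at hXδ
    have := M.gap_neg i1.1 i2.1 i3.1 n21 n23 r2 hend hev ht' hT hTS hX0 hXδ
    rwa [mul_exp_turn hn1 (norm_unitDir X)] at this
  refine ⟨⟨⟨c12, S₁, ⟨i1.1, r1.trans ht.1⟩, S₂, ⟨i2.1, hSt.le⟩, n21.symm, m12⟩,
    ⟨c23, S₂, ⟨i2.1, hSt.le⟩, S₃, ⟨i3.1, r3.trans ht.1⟩, n23, m23⟩, fun heq => ?_,
    fun X hX hXb => not_mem_beachIntersections_of_gap_neg i2.1 hSt (hneg X hXb) hX⟩,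
    fun X hX hXb => mem_activePart_of_gap_neg i2.1 hSt (hneg X hXb) hX⟩
  have h := congrArg unitDir heq
  simp only [unitDir_ellipsePoint hn1 hSt, unitDir_ellipsePoint hn3 hSt] at h
  rw [M.length_eq t ht, h, turn_self hn3] at hδ
  exact lt_irrefl _ hδ
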